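/- For a finite simple graph $G$ on $n$ vertices, let $A$ be its adjacency matrix, $D$ its diagonal matrix of vertex degrees, and $q_1,\dots,q_n$ the eigenvalues (with multiplicity) of the signless Laplacian matrix $Q=D+A$; put $\mathrm{SLEE}(G)=\sum_{i=1}^n e^{q_i}$. A cut vertex of $G$ is a vertex whose removal increases the number of connected components. Graphs are not assumed to be connected. Let $n,r$ be integers with $0\le r\le n-2$. Let $G_n^r$ be a graph obtained from the complete graph $K_{n-r}$ by attaching at its $i$-th vertex ($1\le i\le n-r$) one pendent path with $n_i\ge 0$ vertices in addition to that clique vertex, where $n_1+\dots+n_{n-r}=r$ and $|n_i-n_j|\le 1$ for all $i,j$. Then such integers $n_i$ exist, and for every such choice $G_n^r$ has $n$ vertices and exactly $r$ cut vertices, and every graph $G$ on $n$ vertices with exactly $r$ cut vertices satisfies $$\mathrm{SLEE}(G)\le \mathrm{SLEE}(G_n^r),$$ with equality if and only if $G$ is isomorphic to $G_n^r$. -/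

import Mathlib

namespace SimpleGraph

/-- The signless Laplacian matrix `Q = D + A`. -/
def signlessLapMatrix {V : Type*} [Fintype V] [DecidableEq V] (G : SimpleGraph V)
    [DecidableRel G.Adj] : Matrix V V ℝ :=
  G.degMatrix ℝ + G.adjMatrix ℝ

theorem isHermitian_signlessLapMatrix {V : Type*} [Fintype V] [DecidableEq V]
    (G : SimpleGraph V) [DecidableRel G.Adj] : G.signlessLapMatrix.IsHermitian :=
  (G.isHermitian_degMatrix ℝ).add (G.isHermitian_adjMatrix ℝ)

open Classical in
/-- The signless Laplacian Estrada index `∑ᵢ exp qᵢ`, where `q₁, …, qₙ` are the eigenvalues,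
with multiplicity, of the signless Laplacian matrix. -/
noncomputable def SLEE {V : Type*} [Fintype V] (G : SimpleGraph V) : ℝ :=
  ∑ i : V, Real.exp (G.isHermitian_signlessLapMatrix.eigenvalues i)

/-- A cut vertex is a vertex whose removal increases the number of connected components
(used for graphs with finitely many vertices). -/
def IsCutVertex {V : Type*} (G : SimpleGraph V) (v : V) : Prop :=
  Nat.card G.ConnectedComponent < Nat.card (G.induce ({v}ᶜ : Set V)).ConnectedComponent

/-- The number of cut vertices. -/
noncomputable def cutVertexCount {V : Type*} (G : SimpleGraph V) : ℕ :=
  {v : V | G.IsCutVertex v}.ncard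

/-- The complete graph on `m` vertices with one pendent path attached at each vertex, the path
at the `i`-th vertex having `l i` vertices in addition to that vertex. The pair `⟨i, a⟩` is the
vertex at distance `a` from the clique on the `i`-th path; `⟨i, 0⟩` is the clique vertex. -/
def cliqueWithPaths {m : ℕ} (l : Fin m → ℕ) : SimpleGraph (Σ i : Fin m, Fin (l i + 1)) where
  Adj x y :=
    (x.1 = y.1 ∧ ((x.2 : ℕ) + 1 = y.2 ∨ (y.2 : ℕ) + 1 = x.2)) ∨
      (x.1 ≠ y.1 ∧ (x.2 : ℕ) = 0 ∧ (y.2 : ℕ) = 0)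
  symm := ⟨fun _ _ h => h.imp (fun h => ⟨h.1.symm, h.2.symm⟩) fun h => ⟨h.1.symm, h.2.2, h.2.1⟩⟩
  loopless := ⟨fun _ h => by
    rcases h with ⟨_, h⟩ | ⟨h, _⟩
    · omega
    · exact h rfl⟩

/-- The path orders `l` are those of a graph `G_n^r`: the attached paths have `r` vertices altogether,
and their orders differ pairwise by at most one. -/
def IsBalanced {m : ℕ} (l : Fin m → ℕ) (r : ℕ) : Prop :=
  ∑ i, l i = r ∧ ∀ i j, |(l i : ℤ) - (l j : ℤ)| ≤ 1

end SimpleGraph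

/-! Some graph on the given vertex set maximizes `SLEE` among those with `r` cut vertices. Every
maximizer is shown to be a clique with balanced pendent paths, and all of these are isomorphic, so
the bound and the equality case follow together.

As `SLEE` is the sum of `tr (Q ^ k) / k!`, graphs are compared through these traces. Two operations
raise it strictly. The first is adding edges (`SLEE_lt_of_lt`): so a maximizer is connected, and
nonadjacent vertices are separated by a vertex whose removal leaves two components
(`IsMaxSLEE.exists_separating`). Thus blocks are cliques and a cut vertex lies in just two of them.
The second is moving a star from `w` to `x` (`SLEE_lt_of_star_move`): if `Q = H + N * Nᵀ`, with `N`
the incidence matrix of the star, the traces are monotone in the entries of all `Nᵀ * H ^ i * N`.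
The required inequalities between entries of `H ^ i` come from comparing a pendent path with a
longer nonbacktracking walk from the same vertex.

If there is a triangle, let `b` be a triangle vertex at least distance, `a`, from a non-cut vertex.
The shortest path between them is pendent, and `b` with its other neighbours is a clique `B`. If the
branch at another `c ∈ B` had a triangle or a geodesic from `c` of length at least `a + 2`, the star
of `b` could be moved into that branch, keeping the cut vertices
(`IsMaxSLEE.not_exists_longer_walk`). So each branch is a path of length `a` or `a + 1`. Without
triangles the graph is a path, to be split at a middle edge. -/

namespace SimpleGraph

/-! ### Spectral moments of the signless Laplacian -/

section MatrixMoments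

open Matrix Finset

/-- The trace of a power of a real symmetric matrix is the corresponding power sum of eigenvalues. -/
theorem trace_pow_eq_sum_eigenvalues {V : Type*} [Fintype V] [DecidableEq V]
    {A : Matrix V V ℝ} (hA : A.IsHermitian) (k : ℕ) :
    (A ^ k).trace = ∑ i, hA.eigenvalues i ^ k := by
  have h : A ^ k = Unitary.conjStarAlgAut ℝ _ hA.eigenvectorUnitary
      ((diagonal ((fun x : ℝ => x) ∘ hA.eigenvalues)) ^ k) := by
    rw [map_pow]
    conv_lhs => rw [hA.spectral_theorem]
    rfl
  rw [h, Unitary.conjStarAlgAut_apply, trace_mul_cycle, Unitary.coe_star_mul_self, one_mul,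
    diagonal_pow, trace_diagonal]
  rfl

open Classical in
theorem hasSum_SLEE {V : Type*} [Fintype V] (G : SimpleGraph V) :
    HasSum (fun k : ℕ => (G.signlessLapMatrix ^ k).trace / (k.factorial : ℝ)) G.SLEE := by
  have h : ∀ i, HasSum (fun k : ℕ => G.isHermitian_signlessLapMatrix.eigenvalues i ^ k /
      (k.factorial : ℝ)) (Real.exp (G.isHermitian_signlessLapMatrix.eigenvalues i)) := by
    intro i
    rw [Real.exp_eq_exp_ℝ]
    exact NormedSpace.expSeries_div_hasSum_exp _
  unfold SLEE
  convert hasSum_sum (s := univ) fun i _ => h i using 1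
  ext k
  rw [trace_pow_eq_sum_eigenvalues G.isHermitian_signlessLapMatrix, sum_div]

open Classical in
theorem SLEE_lt_of_trace_pow {V : Type*} [Fintype V] {G G' : SimpleGraph V}
    (hle : ∀ k, (G.signlessLapMatrix ^ k).trace ≤ (G'.signlessLapMatrix ^ k).trace)
    {k : ℕ} (hlt : (G.signlessLapMatrix ^ k).trace < (G'.signlessLapMatrix ^ k).trace) :
    G.SLEE < G'.SLEE := by
  refine hasSum_lt (i := k) (fun j => ?_) ?_ G.hasSum_SLEE G'.hasSum_SLEE
  · have := hle j
    dsimp only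
    gcongr
  · gcongr

section

variable {V : Type*} [Fintype V] [DecidableEq V] (G : SimpleGraph V) [DecidableRel G.Adj]

/-- Degree and adjacency terms are grouped by neighbour. With nonnegative entries, discarding
neighbours can only decrease the sum; all entrywise comparisons below rest on this. -/
theorem signlessLapMatrix_mul_apply (M : Matrix V V ℝ) (u z : V) :
    (G.signlessLapMatrix * M) u z = ∑ x ∈ G.neighborFinset u, (M u z + M x z) := by
  rw [signlessLapMatrix, Matrix.add_mul, Matrix.add_apply, degMatrix, diagonal_mul,
    adjMatrix_mul_apply, sum_add_distrib, sum_const, card_neighborFinset_eq_degree, nsmul_eq_mul]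

theorem signlessLapMatrix_pow_succ_apply (k : ℕ) (u z : V) :
    (G.signlessLapMatrix ^ (k + 1)) u z = ∑ x ∈ G.neighborFinset u,
      ((G.signlessLapMatrix ^ k) u z + (G.signlessLapMatrix ^ k) x z) := by
  rw [pow_succ', signlessLapMatrix_mul_apply]

theorem signlessLapMatrix_pow_apply_nonneg (k : ℕ) (u v : V) :
    0 ≤ (G.signlessLapMatrix ^ k) u v := by
  induction k generalizing u with
  | zero => rw [pow_zero, one_apply]; split_ifs <;> norm_num
  | succ k ih =>
    rw [signlessLapMatrix_pow_succ_apply]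
    exact sum_nonneg fun x _ => add_nonneg (ih _) (ih _)

theorem signlessLapMatrix_pow_apply_comm (k : ℕ) (u v : V) :
    (G.signlessLapMatrix ^ k) u v = (G.signlessLapMatrix ^ k) v u := by
  have h := congrFun (congrFun (G.isHermitian_signlessLapMatrix.pow k) v) u
  simpa using h

theorem signlessLapMatrix_pow_apply_mono {G' : SimpleGraph V} [DecidableRel G'.Adj]
    (h : G ≤ G') (k : ℕ) (u v : V) :
    (G.signlessLapMatrix ^ k) u v ≤ (G'.signlessLapMatrix ^ k) u v := by
  induction k generalizing u with
  | zero => simp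
  | succ k ih =>
    rw [signlessLapMatrix_pow_succ_apply, signlessLapMatrix_pow_succ_apply]
    refine (sum_le_sum fun x _ => add_le_add (ih _) (ih _)).trans
      (sum_le_sum_of_subset_of_nonneg ?_ fun x _ _ => add_nonneg ?_ ?_)
    · intro x hx
      rw [mem_neighborFinset] at hx ⊢
      exact h hx
    all_goals exact signlessLapMatrix_pow_apply_nonneg _ _ _ _

end

open Classical in
/-- Adding edges increases the signless Laplacian Estrada index. -/
theorem SLEE_lt_of_lt {V : Type*} [Fintype V] {G G' : SimpleGraph V} (h : G < G') :
    G.SLEE < G'.SLEE := by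
  have hdiag : ∀ (G : SimpleGraph V) u, G.signlessLapMatrix u u = G.degree u := by
    intro G u
    simp [signlessLapMatrix, degMatrix]
  refine SLEE_lt_of_trace_pow (k := 1)
    (fun k => sum_le_sum fun u _ => signlessLapMatrix_pow_apply_mono _ h.le _ _ _) ?_
  obtain ⟨u, v, h', hG⟩ : ∃ u v, G'.Adj u v ∧ ¬ G.Adj u v := by
    by_contra! hcon
    exact h.not_ge fun u v => hcon u v
  rw [pow_one, pow_one]
  refine sum_lt_sum (fun u _ => ?_) ⟨u, mem_univ _, ?_⟩
  · simpa using signlessLapMatrix_pow_apply_mono _ h.le 1 u u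
  · rw [diag_apply, diag_apply, hdiag, hdiag, Nat.cast_lt]
    refine card_lt_card ⟨fun x hx => ?_, fun hsub => hG ?_⟩
    · rw [mem_neighborFinset] at hx ⊢
      exact h.le hx
    · simpa using hsub ((mem_neighborFinset _ _ _).2 h')

/-! ### Traces of powers of `H + N * Nᵀ` -/

section RankUpdate

variable {V J : Type*} [Fintype V] [DecidableEq V] [Fintype J]

/-- One factor `H + N * Nᵀ` is peeled off: its `H` joins `H ^ i`, its `N * Nᵀ` cuts the word in two.
Iterating reduces everything to the matrices `Nᵀ * H ^ i * N`. -/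
theorem transpose_mul_pow_mul_update (H : Matrix V V ℝ) (N : Matrix V J ℝ) (b i : ℕ) :
    Nᵀ * H ^ i * (H + N * Nᵀ) ^ (b + 1) * N =
      (Nᵀ * H ^ i * N) * (Nᵀ * H ^ 0 * (H + N * Nᵀ) ^ b * N) +
        Nᵀ * H ^ (i + 1) * (H + N * Nᵀ) ^ b * N := by
  rw [pow_succ' (H + N * Nᵀ), pow_succ H i]
  simp only [Matrix.mul_add, Matrix.add_mul, Matrix.mul_assoc, pow_zero, Matrix.one_mul]
  rw [add_comm]

theorem trace_pow_mul_pow_update (H : Matrix V V ℝ) (N : Matrix V J ℝ) (k i : ℕ) :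
    ((H + N * Nᵀ) ^ (k + 1) * H ^ i).trace =
      (Nᵀ * H ^ i * (H + N * Nᵀ) ^ k * N).trace + ((H + N * Nᵀ) ^ k * H ^ (i + 1)).trace := by
  have h : (H + N * Nᵀ) ^ (k + 1) * H ^ i =
      ((H + N * Nᵀ) ^ k * N) * (Nᵀ * H ^ i) + (H + N * Nᵀ) ^ k * H ^ (i + 1) := by
    rw [pow_succ, pow_succ' H i]
    simp only [Matrix.mul_add, Matrix.add_mul, Matrix.mul_assoc]
    rw [add_comm]
  rw [h, trace_add, trace_mul_comm]
  simp only [Matrix.mul_assoc]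

variable {H : Matrix V V ℝ} {N N' : Matrix V J ℝ}

theorem transpose_mul_pow_mul_update_mono (h0 : ∀ (i : ℕ) (p q : J), 0 ≤ (Nᵀ * H ^ i * N) p q)
    (hle : ∀ (i : ℕ) (p q : J), (Nᵀ * H ^ i * N) p q ≤ (N'ᵀ * H ^ i * N') p q) (b : ℕ) :
    ∀ (i : ℕ) (p q : J), 0 ≤ (Nᵀ * H ^ i * (H + N * Nᵀ) ^ b * N) p q ∧
      (Nᵀ * H ^ i * (H + N * Nᵀ) ^ b * N) p q ≤
        (N'ᵀ * H ^ i * (H + N' * N'ᵀ) ^ b * N') p q := by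
  induction b with
  | zero => simpa using fun i p q => ⟨h0 i p q, hle i p q⟩
  | succ b ih =>
    intro i p q
    rw [transpose_mul_pow_mul_update, transpose_mul_pow_mul_update]
    simp only [Matrix.add_apply, mul_apply (M := Nᵀ * H ^ i * N), mul_apply (M := N'ᵀ * H ^ i * N')]
    refine ⟨add_nonneg (sum_nonneg fun x _ => mul_nonneg (h0 _ _ _) (ih _ _ _).1) (ih _ _ _).1,
      add_le_add (sum_le_sum fun x _ => mul_le_mul (hle _ _ _) (ih _ _ _).2 (ih _ _ _).1
        ((h0 _ _ _).trans (hle _ _ _))) (ih _ _ _).2⟩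

/-- The recursion for the trace ends in `tr (Nᵀ * H ^ (i + k) * N)` plus a trace of a power of `H`
alone. The difference of the former terms is kept, since it later yields strictness. -/
theorem trace_pow_update_mono (h0 : ∀ (i : ℕ) (p q : J), 0 ≤ (Nᵀ * H ^ i * N) p q)
    (hle : ∀ (i : ℕ) (p q : J), (Nᵀ * H ^ i * N) p q ≤ (N'ᵀ * H ^ i * N') p q) (k : ℕ) :
    ∀ i, ((H + N * Nᵀ) ^ (k + 1) * H ^ i).trace +
      ((N'ᵀ * H ^ (i + k) * N').trace - (Nᵀ * H ^ (i + k) * N).trace) ≤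
        ((H + N' * N'ᵀ) ^ (k + 1) * H ^ i).trace := by
  induction k with
  | zero =>
    intro i
    rw [trace_pow_mul_pow_update, trace_pow_mul_pow_update]
    simp only [pow_zero, Matrix.mul_one, add_zero]
    linarith
  | succ k ih =>
    intro i
    rw [trace_pow_mul_pow_update _ _ (k + 1), trace_pow_mul_pow_update _ _ (k + 1)]
    have h1 : (Nᵀ * H ^ i * (H + N * Nᵀ) ^ (k + 1) * N).trace ≤
        (N'ᵀ * H ^ i * (H + N' * N'ᵀ) ^ (k + 1) * N').trace :=
      sum_le_sum fun p _ => (transpose_mul_pow_mul_update_mono h0 hle _ _ _ _).2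
    have h2 := ih (i + 1)
    rw [show i + 1 + k = i + (k + 1) by ring] at h2
    linarith

end RankUpdate

/-! ### Moving a star -/

section Star

variable {V : Type*} [Fintype V] [DecidableEq V]

/-- The incidence matrix of the star joining `w` to the vertices of `J`. -/
def starMatrix (w : V) (J : Finset V) : Matrix V J ℝ :=
  fun v j => (if v = w then 1 else 0) + (if v = j then 1 else 0)

theorem starMatrix_transpose_mul_mul_apply (w : V) (J : Finset V) (M : Matrix V V ℝ) (p q : J) :
    ((starMatrix w J)ᵀ * M * starMatrix w J) p q = M w w + M p w + M w q + M p q := by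
  simp only [mul_apply, transpose_apply, starMatrix, add_mul, mul_add, sum_add_distrib, ite_mul,
    mul_ite, one_mul, zero_mul, mul_one, mul_zero, sum_ite_eq', mem_univ, if_true]
  ring

/-- An edge `wj` contributes the rank-one matrix of the vector `e_w + e_j` to `Q`, and these vectors
are the columns of `starMatrix w J`. -/
theorem signlessLapMatrix_eq_add_star {H G : SimpleGraph V} [DecidableRel H.Adj]
    [DecidableRel G.Adj] {w : V} {J : Finset V} (hw : w ∉ J) (hJ : ∀ j ∈ J, ¬ H.Adj w j)
    (hG : ∀ u v, G.Adj u v ↔ H.Adj u v ∨ (u = w ∧ v ∈ J) ∨ (v = w ∧ u ∈ J)) :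
    G.signlessLapMatrix = H.signlessLapMatrix + starMatrix w J * (starMatrix w J)ᵀ := by
  -- Multiplying by an arbitrary `M`, finally `M = 1`, makes the sum over neighbours available.
  have key : ∀ M : Matrix V V ℝ, G.signlessLapMatrix * M =
      (H.signlessLapMatrix + starMatrix w J * (starMatrix w J)ᵀ) * M := by
    intro M
    ext u z
    have hN : ((starMatrix w J * (starMatrix w J)ᵀ) * M) u z =
        ∑ j ∈ J, ((if u = w then 1 else 0) + (if u = j then 1 else 0)) * (M w z + M j z) := by
      rw [Matrix.mul_assoc, mul_apply, ← sum_coe_sort J]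
      refine sum_congr rfl fun j _ => ?_
      simp [mul_apply, starMatrix, add_mul, sum_add_distrib]
    rw [Matrix.add_mul, Matrix.add_apply, hN, signlessLapMatrix_mul_apply, signlessLapMatrix_mul_apply]
    by_cases hu : u = w
    · subst hu
      have h1 : G.neighborFinset u = H.neighborFinset u ∪ J := by
        ext x
        simp only [mem_neighborFinset, mem_union, hG]
        have : u = x → x ∉ J := by rintro rfl; exact hw
        grind
      rw [h1, sum_union (disjoint_right.2 fun j hj => by simpa using hJ j hj)]
      congr 1
      refine sum_congr rfl fun j hj => ?_
      have : u ≠ j := by rintro rfl; exact hw hj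
      simp [this]
    · by_cases huJ : u ∈ J
      · have h1 : G.neighborFinset u = H.neighborFinset u ∪ {w} := by
          ext x
          simp only [mem_neighborFinset, mem_union, hG, mem_singleton]
          grind
        have h2 : Disjoint (H.neighborFinset u) {w} := by
          rw [disjoint_singleton_right, mem_neighborFinset, adj_comm]
          exact hJ u huJ
        rw [h1, sum_union h2, sum_singleton]
        congr 1
        simp [hu, ite_mul, huJ, add_comm]
      · have h1 : G.neighborFinset u = H.neighborFinset u := by
          ext x
          simp only [mem_neighborFinset, hG]
          grind
        rw [h1, sum_eq_zero (s := J), add_zero]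
        intro j hj
        have : u ≠ j := by rintro rfl; exact huJ hj
        simp [hu, this]
  simpa using key 1

end Star

open Classical in
/-- If the walks of `H` issuing from `w` are dominated by those issuing from `x`, then a star
centred at `x` increases the Estrada index more than the same star centred at `w`. -/
theorem SLEE_lt_of_star_move {V : Type*} [Fintype V] {H G G' : SimpleGraph V} {w x : V}
    {J : Finset V} (hne : J.Nonempty) (hw : w ∉ J) (hx : x ∉ J)
    (hwJ : ∀ j ∈ J, ¬ H.Adj w j) (hxJ : ∀ j ∈ J, ¬ H.Adj x j)
    (hG : ∀ u v, G.Adj u v ↔ H.Adj u v ∨ (u = w ∧ v ∈ J) ∨ (v = w ∧ u ∈ J))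
    (hG' : ∀ u v, G'.Adj u v ↔ H.Adj u v ∨ (u = x ∧ v ∈ J) ∨ (v = x ∧ u ∈ J))
    (hle : ∀ k, (H.signlessLapMatrix ^ k) w w ≤ (H.signlessLapMatrix ^ k) x x)
    (hleJ : ∀ k, ∀ j ∈ J, (H.signlessLapMatrix ^ k) w j ≤ (H.signlessLapMatrix ^ k) x j)
    (hlt : ∃ k, (H.signlessLapMatrix ^ k) w w < (H.signlessLapMatrix ^ k) x x) :
    G.SLEE < G'.SLEE := by
  have hN0 : ∀ (i : ℕ) (p q : J), 0 ≤ ((starMatrix w J)ᵀ * H.signlessLapMatrix ^ i * starMatrix w J) p q := by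
    intro i p q
    rw [starMatrix_transpose_mul_mul_apply]
    have := H.signlessLapMatrix_pow_apply_nonneg i
    exact add_nonneg (add_nonneg (add_nonneg (this _ _) (this _ _)) (this _ _)) (this _ _)
  have hNle : ∀ (i : ℕ) (p q : J), ((starMatrix w J)ᵀ * H.signlessLapMatrix ^ i * starMatrix w J) p q ≤
      ((starMatrix x J)ᵀ * H.signlessLapMatrix ^ i * starMatrix x J) p q := by
    intro i p q
    rw [starMatrix_transpose_mul_mul_apply, starMatrix_transpose_mul_mul_apply,
      signlessLapMatrix_pow_apply_comm _ _ (p : V) w, signlessLapMatrix_pow_apply_comm _ _ (p : V) x]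
    have h1 := hle i
    have h2 := hleJ i p p.2
    have h3 := hleJ i q q.2
    linarith
  have hmono := trace_pow_update_mono hN0 hNle
  rw [← signlessLapMatrix_eq_add_star hw hwJ hG, ← signlessLapMatrix_eq_add_star hx hxJ hG']
    at hmono
  have htr : ∀ k, ((starMatrix w J)ᵀ * H.signlessLapMatrix ^ k * starMatrix w J).trace ≤
      ((starMatrix x J)ᵀ * H.signlessLapMatrix ^ k * starMatrix x J).trace :=
    fun k => sum_le_sum fun p _ => hNle k p p
  obtain ⟨k, hk⟩ := hlt
  refine SLEE_lt_of_trace_pow (k := k + 1) (fun k => ?_) ?_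
  · cases k with
    | zero => simp
    | succ k =>
      have h1 := hmono k 0
      have h2 := htr (0 + k)
      rw [pow_zero, mul_one, mul_one] at h1
      linarith
  · have h1 := hmono k 0
    have h2 : ((starMatrix w J)ᵀ * H.signlessLapMatrix ^ k * starMatrix w J).trace <
        ((starMatrix x J)ᵀ * H.signlessLapMatrix ^ k * starMatrix x J).trace := by
      obtain ⟨j, hj⟩ := hne
      refine sum_lt_sum (fun p _ => hNle k p p) ⟨⟨j, hj⟩, mem_univ _, ?_⟩
      rw [diag_apply, diag_apply, starMatrix_transpose_mul_mul_apply,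
        starMatrix_transpose_mul_mul_apply, signlessLapMatrix_pow_apply_comm _ _ (j : V) w,
        signlessLapMatrix_pow_apply_comm _ _ (j : V) x]
      have h3 := hleJ k j hj
      linarith
    rw [pow_zero, mul_one, mul_one, zero_add] at h1
    linarith

/-! ### A pendent path against a longer nonbacktracking walk -/

section Domination

variable {V : Type*} [Fintype V] [DecidableEq V] {H : SimpleGraph V} [DecidableRel H.Adj]
  {a : ℕ} {w y : ℕ → V}

theorem pow_succ_apply_path (hN : ∀ i, 1 ≤ i → i ≤ a → ∀ u, H.Adj (w i) u ↔
      u = w (i - 1) ∨ (i < a ∧ u = w (i + 1)))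
    (hne : ∀ i, i + 2 ≤ a → w i ≠ w (i + 2)) {i : ℕ} (hi1 : 1 ≤ i) (hia : i ≤ a) (k : ℕ) (z : V) :
    (H.signlessLapMatrix ^ (k + 1)) (w i) z =
      ((H.signlessLapMatrix ^ k) (w i) z + (H.signlessLapMatrix ^ k) (w (i - 1)) z) +
      if i < a then (H.signlessLapMatrix ^ k) (w i) z + (H.signlessLapMatrix ^ k) (w (i + 1)) z
        else 0 := by
  rw [signlessLapMatrix_pow_succ_apply]
  split_ifs with hlt
  · have h1 : H.neighborFinset (w i) = {w (i - 1), w (i + 1)} := by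
      ext u
      rw [mem_neighborFinset, hN i hi1 hia]
      simp [hlt]
    have h2 := hne (i - 1) (by omega)
    rw [show i - 1 + 2 = i + 1 by omega] at h2
    rw [h1, sum_pair h2]
  · have h1 : H.neighborFinset (w i) = {w (i - 1)} := by
      ext u
      rw [mem_neighborFinset, hN i hi1 hia]
      simp [hlt]
    rw [h1, sum_singleton, add_zero]

/-- Each `y i` has at least two distinct neighbours, even `y a`, because the walk goes on to `y (a +
1)`. The end `w a` of the pendent path has only one. -/
theorem le_pow_succ_apply_walk (hy : ∀ i ≤ a, H.Adj (y i) (y (i + 1)))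
    (hyne : ∀ i < a, y i ≠ y (i + 2)) {i : ℕ} (hi1 : 1 ≤ i) (hia : i ≤ a) (k : ℕ) (z : V) :
    ((H.signlessLapMatrix ^ k) (y i) z + (H.signlessLapMatrix ^ k) (y (i - 1)) z) +
      ((H.signlessLapMatrix ^ k) (y i) z + (H.signlessLapMatrix ^ k) (y (i + 1)) z) ≤
    (H.signlessLapMatrix ^ (k + 1)) (y i) z := by
  rw [signlessLapMatrix_pow_succ_apply]
  have h2 := hyne (i - 1) (by omega)
  rw [show i - 1 + 2 = i + 1 by omega] at h2
  rw [← sum_pair (f := fun x => (H.signlessLapMatrix ^ k) (y i) z +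
    (H.signlessLapMatrix ^ k) x z) h2]
  refine sum_le_sum_of_subset_of_nonneg (fun u hu => ?_)
    fun x _ _ => add_nonneg (signlessLapMatrix_pow_apply_nonneg _ _ _ _)
      (signlessLapMatrix_pow_apply_nonneg _ _ _ _)
  rw [mem_neighborFinset]
  rw [mem_insert, mem_singleton] at hu
  rcases hu with rfl | rfl
  · have := hy (i - 1) (by omega)
    rw [show i - 1 + 1 = i by omega] at this
    exact this.symm
  · exact hy i hia

variable (h0 : w 0 = y 0)
  (hN : ∀ i, 1 ≤ i → i ≤ a → ∀ u, H.Adj (w i) u ↔ u = w (i - 1) ∨ (i < a ∧ u = w (i + 1)))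
  (hne : ∀ i, i + 2 ≤ a → w i ≠ w (i + 2))
  (hy : ∀ i ≤ a, H.Adj (y i) (y (i + 1))) (hyne : ∀ i < a, y i ≠ y (i + 2))

include h0 hN hne hy hyne

/-- Walks from a pendent path to outside are dominated by walks from a nonbacktracking walk with
the same initial vertex. -/
theorem pow_apply_path_le_walk {z : V} (hz : ∀ i, 1 ≤ i → i ≤ a → w i ≠ z) (k : ℕ) :
    ∀ i ≤ a, (H.signlessLapMatrix ^ k) (w i) z ≤ (H.signlessLapMatrix ^ k) (y i) z := by
  induction k with
  | zero =>
    intro i hi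
    rcases Nat.eq_zero_or_pos i with rfl | hi1
    · rw [h0]
    · rw [pow_zero, one_apply_ne (hz i hi1 hi), one_apply]
      split_ifs <;> norm_num
  | succ k ih =>
    intro i hi
    rcases Nat.eq_zero_or_pos i with rfl | hi1
    · rw [h0]
    · rw [pow_succ_apply_path hN hne hi1 hi]
      refine le_trans ?_ (le_pow_succ_apply_walk hy hyne hi1 hi k z)
      refine add_le_add (add_le_add (ih i hi) (ih _ (by omega))) ?_
      split_ifs with hlt
      · exact add_le_add (ih i hi) (ih _ (by omega))
      · exact add_nonneg (signlessLapMatrix_pow_apply_nonneg _ _ _ _)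
          (signlessLapMatrix_pow_apply_nonneg _ _ _ _)

variable (hinj : ∀ i ≤ a, ∀ j ≤ a, w i = w j → i = j)

include hinj

theorem pow_apply_path_path_le_walk_walk (k : ℕ) : ∀ i ≤ a, ∀ j ≤ a,
    (H.signlessLapMatrix ^ k) (w i) (w j) ≤ (H.signlessLapMatrix ^ k) (y i) (y j) := by
  -- At index `0`, symmetry turns the common start into the fixed target `z` of the preceding
  -- theorem.
  have hbase : ∀ k, ∀ j ≤ a,
      (H.signlessLapMatrix ^ k) (w 0) (w j) ≤ (H.signlessLapMatrix ^ k) (y 0) (y j) := by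
    intro k j hj
    rw [signlessLapMatrix_pow_apply_comm, signlessLapMatrix_pow_apply_comm _ _ (y 0), ← h0]
    refine pow_apply_path_le_walk h0 hN hne hy hyne (fun i hi1 hia heq => ?_) k j hj
    have := hinj i hia 0 (by omega) heq
    omega
  induction k with
  | zero =>
    intro i hi j hj
    rw [pow_zero, one_apply, one_apply]
    by_cases hij : i = j
    · subst hij; simp
    · rw [if_neg fun h => hij (hinj i hi j hj h)]
      split_ifs <;> norm_num
  | succ k ih =>
    intro i hi j hj
    rcases Nat.eq_zero_or_pos i with rfl | hi1
    · exact hbase _ j hj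
    · rw [pow_succ_apply_path hN hne hi1 hi]
      refine le_trans ?_ (le_pow_succ_apply_walk hy hyne hi1 hi k _)
      refine add_le_add (add_le_add (ih i hi j hj) (ih _ (by omega) j hj)) ?_
      split_ifs with hlt
      · exact add_le_add (ih i hi j hj) (ih _ (by omega) j hj)
      · exact add_nonneg (signlessLapMatrix_pow_apply_nonneg _ _ _ _)
          (signlessLapMatrix_pow_apply_nonneg _ _ _ _)

theorem exists_pow_apply_path_lt_step {i j : ℕ} (hi1 : 1 ≤ i) (hia : i < a) (hj : j ≤ a)
    (h : ∃ k, (H.signlessLapMatrix ^ k) (w (i + 1)) (w j) <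
      (H.signlessLapMatrix ^ k) (y (i + 1)) (y j)) :
    ∃ k, (H.signlessLapMatrix ^ k) (w i) (w j) < (H.signlessLapMatrix ^ k) (y i) (y j) := by
  obtain ⟨k, hk⟩ := h
  have ih := pow_apply_path_path_le_walk_walk h0 hN hne hy hyne hinj k
  refine ⟨k + 1, ?_⟩
  rw [pow_succ_apply_path hN hne hi1 hia.le, if_pos hia]
  refine lt_of_lt_of_le ?_ (le_pow_succ_apply_walk hy hyne hi1 hia.le k _)
  exact add_lt_add_of_le_of_lt (add_le_add (ih i hia.le j hj) (ih _ (by omega) j hj))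
    (add_lt_add_of_le_of_lt (ih i hia.le j hj) hk)

/-- Strictness starts at `(a, a)` with exponent `1`, where degree one meets degree at least two. It
is carried down to index `1` in one argument, then, by symmetry, in the other. -/
theorem exists_pow_apply_path_lt_walk (ha : 1 ≤ a) :
    ∃ k, (H.signlessLapMatrix ^ k) (w 1) (w 1) < (H.signlessLapMatrix ^ k) (y 1) (y 1) := by
  have step : ∀ j ≤ a, (∃ k, (H.signlessLapMatrix ^ k) (w a) (w j) <
      (H.signlessLapMatrix ^ k) (y a) (y j)) → ∀ i, 1 ≤ i → i ≤ a →
      ∃ k, (H.signlessLapMatrix ^ k) (w i) (w j) < (H.signlessLapMatrix ^ k) (y i) (y j) := by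
    intro j hj h i hi1 hia
    induction hia using Nat.decreasingInduction with
    | self => exact h
    | of_succ i hlt ih =>
      exact exists_pow_apply_path_lt_step h0 hN hne hy hyne hinj hi1 hlt hj (ih (by omega))
  have htop : ∃ k, (H.signlessLapMatrix ^ k) (w a) (w a) <
      (H.signlessLapMatrix ^ k) (y a) (y a) := by
    refine ⟨1, ?_⟩
    have h1 := pow_succ_apply_path hN hne ha le_rfl 0 (w a)
    have h2 := le_pow_succ_apply_walk hy hyne ha le_rfl 0 (y a)
    have ih := pow_apply_path_path_le_walk_walk h0 hN hne hy hyne hinj 0 (a - 1) (by omega) a le_rfl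
    have h3 := H.signlessLapMatrix_pow_apply_nonneg 0 (y (a + 1)) (y a)
    have h4 : (H.signlessLapMatrix ^ 0) (w a) (w a) = 1 := by simp
    have h5 : (H.signlessLapMatrix ^ 0) (y a) (y a) = 1 := by simp
    rw [if_neg (lt_irrefl _)] at h1
    rw [zero_add] at h1 h2
    linarith
  refine step 1 ha ?_ 1 le_rfl ha
  obtain ⟨k, hk⟩ := step a le_rfl htop 1 le_rfl ha
  refine ⟨k, ?_⟩
  rwa [signlessLapMatrix_pow_apply_comm, signlessLapMatrix_pow_apply_comm _ _ (y a)]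

end Domination

end MatrixMoments

/-! ### Cut vertices and reachability avoiding a vertex -/

section CutVertices

variable {V : Type*} {G G' : SimpleGraph V} {u v x y z : V}

theorem Reachable.mem_of_closed {P : V → Prop} (hP : ∀ u v, G.Adj u v → P u → P v)
    (h : G.Reachable x y) (hx : P x) : P y := by
  rw [reachable_iff_reflTransGen] at h
  induction h with
  | refl => exact hx
  | tail _ hadj ih => exact hP _ _ hadj ih

theorem Reachable.of_adj_imp_reachable (hP : ∀ u v, G.Adj u v → G'.Reachable u v)
    (h : G.Reachable x y) : G'.Reachable x y :=
  h.mem_of_closed (P := fun z => G'.Reachable x z) (fun _ _ hadj hu => hu.trans (hP _ _ hadj))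
    (Reachable.refl _)

/-- `G.ReachAvoid v x y`: there is a walk from `x` to `y` none of whose edges is incident
with `v`. -/
abbrev ReachAvoid (G : SimpleGraph V) (v x y : V) : Prop :=
  (G.deleteIncidenceSet v).Reachable x y

theorem Adj.reachAvoid (h : G.Adj x y) (hx : x ≠ v) (hy : y ≠ v) : G.ReachAvoid v x y :=
  Adj.reachable (deleteIncidenceSet_adj.2 ⟨h, hx, hy⟩)

theorem ReachAvoid.ne (h : G.ReachAvoid v x y) (hx : x ≠ v) : y ≠ v :=
  h.mem_of_closed (P := fun z => z ≠ v) (fun _ _ hadj _ => (deleteIncidenceSet_adj.1 hadj).2.2) hx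

theorem ReachAvoid.mono (hle : G ≤ G') (h : G.ReachAvoid v x y) : G'.ReachAvoid v x y :=
  Reachable.mono (fun _ _ hadj => deleteIncidenceSet_adj.2
    ⟨hle (deleteIncidenceSet_adj.1 hadj).1, (deleteIncidenceSet_adj.1 hadj).2⟩) h

theorem ReachAvoid.reachable (h : G.ReachAvoid v x y) : G.Reachable x y :=
  Reachable.mono (deleteIncidenceSet_le _ _) h

theorem induce_compl_reachable_iff {x y : ({v}ᶜ : Set V)} :
    (G.induce ({v}ᶜ : Set V)).Reachable x y ↔ G.ReachAvoid v x y := by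
  constructor
  · intro h
    refine Reachable.mem_of_closed
      (P := fun z : ({v}ᶜ : Set V) => G.ReachAvoid v x z) (fun a b hadj ha => ?_) h
      (Reachable.refl _)
    exact ha.trans (Adj.reachAvoid hadj a.2 b.2)
  · intro h
    have := h.mem_of_closed (P := fun z => ∃ hz : z ∈ ({v}ᶜ : Set V),
      (G.induce ({v}ᶜ : Set V)).Reachable x ⟨z, hz⟩) (fun a b hadj ⟨ha, hr⟩ => ?_)
      ⟨x.2, Reachable.refl _⟩
    · exact this.2
    · rw [deleteIncidenceSet_adj] at hadj
      exact ⟨hadj.2.2, hr.trans (Adj.reachable (by simpa using hadj.1))⟩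

theorem reachAvoid_of_reachable (hv : ∀ x y, G.Adj v x → G.Adj v y → G.ReachAvoid v x y)
    (h : G.Reachable x y) (hx : x ≠ v) (hy : y ≠ v) : G.ReachAvoid v x y := by
  -- The invariant also covers a walk standing at `v`: then all neighbours of `v` have been reached,
  -- so it may leave by any of them.
  have := h.mem_of_closed (P := fun z => (z ≠ v → G.ReachAvoid v x z) ∧
    (z = v → ∀ u, G.Adj v u → G.ReachAvoid v x u)) (fun a b hadj ha => ?_)
    ⟨fun _ => Reachable.refl _, fun h => absurd h hx⟩
  · exact this.1 hy
  · by_cases hav : a = v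
    · subst hav
      exact ⟨fun _ => ha.2 rfl b hadj, fun hb => absurd hb hadj.ne'⟩
    · refine ⟨fun hb => (ha.1 hav).trans (hadj.reachAvoid hav hb), ?_⟩
      rintro rfl u hu
      exact (ha.1 hav).trans (hv _ _ hadj.symm hu)

/-- A vertex is a cut vertex if and only if it separates two of its neighbours. -/
theorem isCutVertex_iff [Finite V] :
    G.IsCutVertex v ↔ ∃ x y, G.Adj v x ∧ G.Adj v y ∧ ¬ G.ReachAvoid v x y := by
  classical
  let f : (G.induce ({v}ᶜ : Set V)).ConnectedComponent → G.ConnectedComponent :=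
    ConnectedComponent.map (Embedding.induce _).toHom
  have hf : ∀ x, f ((G.induce ({v}ᶜ : Set V)).connectedComponentMk x) =
    G.connectedComponentMk x := fun x => rfl
  constructor
  · intro h
    by_contra! hcon
    refine absurd (Nat.card_le_card_of_injective f ?_) (not_le.2 h)
    intro c d
    induction c using ConnectedComponent.ind with | _ c
    induction d using ConnectedComponent.ind with | _ d
    intro hcd
    rw [hf, hf, ConnectedComponent.eq] at hcd
    rw [ConnectedComponent.eq, induce_compl_reachable_iff]
    exact reachAvoid_of_reachable hcon hcd c.2 d.2
  · rintro ⟨x, y, hx, hy, hxy⟩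
    have hsurj : Function.Surjective f := by
      intro c
      induction c using ConnectedComponent.ind with | _ c
      by_cases hc : c = v
      · subst hc
        exact ⟨connectedComponentMk _ ⟨x, hx.ne'⟩, ConnectedComponent.sound hx.symm.reachable⟩
      · exact ⟨connectedComponentMk _ ⟨c, hc⟩, rfl⟩
    refine lt_of_le_of_ne (Nat.card_le_card_of_surjective f hsurj) fun heq => hxy ?_
    have hinj := ((Nat.bijective_iff_surjective_and_card f).2 ⟨hsurj, heq.symm⟩).injective
    have := @hinj (connectedComponentMk _ ⟨x, hx.ne'⟩) (connectedComponentMk _ ⟨y, hy.ne'⟩)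
      (ConnectedComponent.sound (hx.symm.reachable.trans hy.reachable))
    rw [ConnectedComponent.eq, induce_compl_reachable_iff] at this
    exact this

theorem not_isCutVertex_iff [Finite V] :
    ¬ G.IsCutVertex v ↔ ∀ x y, G.Adj v x → G.Adj v y → G.ReachAvoid v x y := by
  rw [isCutVertex_iff]
  push Not
  rfl

theorem IsCutVertex.of_not_reachAvoid [Finite V] (hG : G.Connected) (hx : x ≠ v) (hy : y ≠ v)
    (h : ¬ G.ReachAvoid v x y) : G.IsCutVertex v := by
  by_contra hcon
  exact h (reachAvoid_of_reachable (not_isCutVertex_iff.1 hcon) (hG x y) hx hy)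

theorem not_isCutVertex_of_clique [Finite V]
    (h : ∀ x y, G.Adj v x → G.Adj v y → x ≠ y → G.Adj x y) : ¬ G.IsCutVertex v := by
  rw [not_isCutVertex_iff]
  intro x y hx hy
  rcases eq_or_ne x y with rfl | hxy
  · exact Reachable.refl _
  · exact (h x y hx hy hxy).reachAvoid hx.ne' hy.ne'

theorem cutVertexCount_congr (h : ∀ v, G.IsCutVertex v ↔ G'.IsCutVertex v) :
    G.cutVertexCount = G'.cutVertexCount := by
  simp only [cutVertexCount, h]

theorem ReachAvoid.map {W : Type*} {H : SimpleGraph W} (φ : G ≃g H) (h : G.ReachAvoid v x y) :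
    H.ReachAvoid (φ v) (φ x) (φ y) := by
  refine h.mem_of_closed (P := fun z => H.ReachAvoid (φ v) (φ x) (φ z)) (fun a b hadj ha => ?_)
    (Reachable.refl _)
  rw [deleteIncidenceSet_adj] at hadj
  exact ha.trans (Adj.reachAvoid (φ.map_adj_iff.2 hadj.1) (by simpa using hadj.2.1)
    (by simpa using hadj.2.2))

theorem IsCutVertex.map {W : Type*} {H : SimpleGraph W} [Finite V] [Finite W] (φ : G ≃g H)
    (h : G.IsCutVertex v) : H.IsCutVertex (φ v) := by
  obtain ⟨x, y, hx, hy, h⟩ := SimpleGraph.isCutVertex_iff.1 h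
  refine SimpleGraph.isCutVertex_iff.2
    ⟨φ x, φ y, φ.map_adj_iff.2 hx, φ.map_adj_iff.2 hy, fun hcon => h ?_⟩
  simpa using hcon.map φ.symm

theorem Iso.isCutVertex_iff {W : Type*} {H : SimpleGraph W} [Finite V] [Finite W] (φ : G ≃g H)
    (v : V) : H.IsCutVertex (φ v) ↔ G.IsCutVertex v :=
  ⟨fun h => by simpa using h.map φ.symm, fun h => h.map φ⟩

theorem Iso.cutVertexCount_eq {W : Type*} {H : SimpleGraph W} [Finite V] [Finite W] (φ : G ≃g H) :
    H.cutVertexCount = G.cutVertexCount := by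
  have h : {w | H.IsCutVertex w} = φ '' {v | G.IsCutVertex v} := by
    ext w
    obtain ⟨v, rfl⟩ := φ.surjective w
    simp only [Set.mem_ofPred_eq, Iso.isCutVertex_iff, Set.mem_image]
    exact ⟨fun h => ⟨v, h, rfl⟩, fun ⟨u, hu, h⟩ => φ.injective h ▸ hu⟩
  rw [cutVertexCount, cutVertexCount, h, Set.ncard_image_of_injective _ φ.injective]

end CutVertices

/-! ### Joining two components without changing the cut vertices -/

section Join

variable {V : Type*} [Finite V] {G : SimpleGraph V} {x₁ x₂ : V} {U₁ U₂ : Set V}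

/-- The graph obtained from `G` by joining every vertex of `U₁` with every vertex of `U₂`. -/
def joinSets (G : SimpleGraph V) (U₁ U₂ : Set V) (h : Disjoint U₁ U₂) : SimpleGraph V where
  Adj u v := G.Adj u v ∨ (u ∈ U₁ ∧ v ∈ U₂) ∨ (u ∈ U₂ ∧ v ∈ U₁)
  symm := ⟨fun _ _ h => h.imp (fun h => h.symm) fun h => h.symm.imp And.symm And.symm⟩
  loopless := ⟨fun v hv => by
    rcases hv with hv | hv | hv
    · exact G.irrefl hv
    · exact Set.disjoint_left.1 h hv.1 hv.2
    · exact Set.disjoint_left.1 h hv.2 hv.1⟩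

omit [Finite V] in
theorem joinSets_comm (h : Disjoint U₁ U₂) : G.joinSets U₁ U₂ h = G.joinSets U₂ U₁ h.symm := by
  ext u v
  simp only [joinSets]
  tauto

omit [Finite V] in
theorem le_joinSets (h : Disjoint U₁ U₂) : G ≤ G.joinSets U₁ U₂ h := fun _ _ hadj => Or.inl hadj

/-- `U` is either a single cut vertex in the component of `x`, or that whole component, in the
case where it has no cut vertex. -/
def IsAttachingSet (G : SimpleGraph V) (x : V) (U : Set V) : Prop :=
  (∃ c, G.Reachable x c ∧ G.IsCutVertex c ∧ U = {c}) ∨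
    ((∀ z, G.Reachable x z → ¬ G.IsCutVertex z) ∧ U = {z | G.Reachable x z})

omit [Finite V] in
theorem exists_isAttachingSet (G : SimpleGraph V) (x : V) : ∃ U, G.IsAttachingSet x U := by
  by_cases h : ∃ c, G.Reachable x c ∧ G.IsCutVertex c
  · obtain ⟨c, hc, hc'⟩ := h
    exact ⟨{c}, Or.inl ⟨c, hc, hc', rfl⟩⟩
  · push Not at h
    exact ⟨_, Or.inr ⟨h, rfl⟩⟩

omit [Finite V] in
theorem IsAttachingSet.reachable {U : Set V} {x z : V} (h : G.IsAttachingSet x U) (hz : z ∈ U) :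
    G.Reachable x z := by
  rcases h with ⟨c, hc, -, rfl⟩ | ⟨-, rfl⟩
  · rw [Set.mem_singleton_iff.1 hz]
    exact hc
  · exact hz

omit [Finite V] in
theorem IsAttachingSet.nonempty {U : Set V} {x : V} (h : G.IsAttachingSet x U) : U.Nonempty := by
  rcases h with ⟨c, -, -, rfl⟩ | ⟨-, rfl⟩
  · exact ⟨c, rfl⟩
  · exact ⟨x, Reachable.refl _⟩

omit [Finite V] in
theorem IsAttachingSet.disjoint (h₁ : G.IsAttachingSet x₁ U₁) (h₂ : G.IsAttachingSet x₂ U₂)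
    (hx : ¬ G.Reachable x₁ x₂) : Disjoint U₁ U₂ :=
  Set.disjoint_left.2 fun _ hz₁ hz₂ => hx ((h₁.reachable hz₁).trans (h₂.reachable hz₂).symm)

/-- If `U₁` is a single cut vertex, that vertex stays one, and the new part hangs behind it. If `U₁`
is a whole component, every vertex of it sees `U₂`, so removing one of them separates nothing. -/
theorem isCutVertex_joinSets_iff_aux (h₁ : G.IsAttachingSet x₁ U₁) (h₂ : G.IsAttachingSet x₂ U₂)
    (hx : ¬ G.Reachable x₁ x₂) {v : V} (hv : ¬ G.Reachable x₂ v) :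
    (G.joinSets U₁ U₂ (h₁.disjoint h₂ hx)).IsCutVertex v ↔ G.IsCutVertex v := by
  set G' := G.joinSets U₁ U₂ (h₁.disjoint h₂ hx) with hG'
  have hle : G ≤ G' := le_joinSets _
  constructor
  · contrapose!
    intro hnc
    have hnc' := not_isCutVertex_iff.1 hnc
    rw [not_isCutVertex_iff]
    by_cases hvU : v ∈ U₁
    · have hU₁ : U₁ = {z | G.Reachable x₁ z} := by
        rcases h₁ with ⟨c, hc, hcut, rfl⟩ | ⟨-, h⟩
        · rw [Set.mem_singleton_iff.1 hvU] at hnc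
          exact absurd hcut hnc
        · exact h
      obtain ⟨u₂, hu₂⟩ := h₂.nonempty
      have hreach : ∀ z, G'.Adj v z → G'.ReachAvoid v z u₂ := by
        intro z hz
        have hu₂v : u₂ ≠ v := by
          rintro rfl
          exact hv (h₂.reachable hu₂)
        rcases hz with hz | hz | hz
        · have hzU : z ∈ U₁ := by
            rw [hU₁] at hvU ⊢
            exact hvU.trans hz.reachable
          exact Adj.reachAvoid (Or.inr (Or.inl ⟨hzU, hu₂⟩)) hz.ne' hu₂v
        · have hzu : G.Reachable z u₂ := (h₂.reachable hz.2).symm.trans (h₂.reachable hu₂)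
          have hvz : v ≠ z := fun h => hv (h ▸ h₂.reachable hz.2)
          refine ReachAvoid.mono hle ?_
          exact reachAvoid_of_reachable hnc' hzu hvz.symm hu₂v
        · exact absurd (h₂.reachable hz.1) hv
      intro a b ha hb
      exact (hreach a ha).trans (hreach b hb).symm
    · have hvU₂ : v ∉ U₂ := fun h => hv (h₂.reachable h)
      intro a b ha hb
      refine ReachAvoid.mono hle (hnc' a b ?_ ?_)
      · rcases ha with h | h | h
        exacts [h, absurd h.1 hvU, absurd h.1 hvU₂]
      · rcases hb with h | h | h
        exacts [h, absurd h.1 hvU, absurd h.1 hvU₂]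
  · intro hcut
    obtain ⟨a, b, ha, hb, hab⟩ := isCutVertex_iff.1 hcut
    refine isCutVertex_iff.2 ⟨a, b, hle ha, hle hb, fun hcon => hab ?_⟩
    have hva : ¬ G.Reachable x₂ a := fun h => hv (h.trans ha.symm.reachable)
    have hvb : ¬ G.Reachable x₂ b := fun h => hv (h.trans hb.symm.reachable)
    by_cases hv₁ : G.Reachable x₁ v
    · obtain ⟨c, hc, -, rfl⟩ : ∃ c, G.Reachable x₁ c ∧ G.IsCutVertex c ∧ U₁ = {c} := by
        rcases h₁ with h | h
        · exact h
        · exact absurd hcut (h.1 v hv₁)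
      -- A walk visiting the component of `x₂` enters and leaves through `c`, so the excursion can
      -- be cut out.
      have := hcon.mem_of_closed (P := fun z => G.ReachAvoid v a z ∨
        (G.Reachable x₂ z ∧ G.ReachAvoid v a c)) (fun p q hadj hp => ?_) (Or.inl (Reachable.refl _))
      · exact this.resolve_right fun h => hvb h.1
      · rw [deleteIncidenceSet_adj] at hadj
        obtain ⟨h | h | h, hpv, hqv⟩ := hadj
        · exact hp.imp (fun hp => hp.trans (h.reachAvoid hpv hqv))
            fun hp => ⟨hp.1.trans h.reachable, hp.2⟩
        · obtain rfl := Set.mem_singleton_iff.1 h.1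
          refine Or.inr ⟨h₂.reachable h.2, hp.elim id fun h => h.2⟩
        · obtain rfl := Set.mem_singleton_iff.1 h.2
          refine Or.inl (hp.elim (fun hp => ?_) fun h => h.2)
          exact absurd ((h₂.reachable h.1).trans (hp.reachable.symm)) hva
    · refine hcon.mem_of_closed (P := fun z => G.ReachAvoid v a z) (fun p q hadj hp => ?_)
        (Reachable.refl _)
      rw [deleteIncidenceSet_adj] at hadj
      obtain ⟨h | h | h, hpv, hqv⟩ := hadj
      · exact hp.trans (h.reachAvoid hpv hqv)
      · exact absurd (((h₁.reachable h.1).trans hp.reachable.symm).trans ha.symm.reachable) hv₁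
      · exact absurd ((h₂.reachable h.1).trans hp.reachable.symm) hva

theorem isCutVertex_joinSets_iff (h₁ : G.IsAttachingSet x₁ U₁) (h₂ : G.IsAttachingSet x₂ U₂)
    (hx : ¬ G.Reachable x₁ x₂) (v : V) :
    (G.joinSets U₁ U₂ (h₁.disjoint h₂ hx)).IsCutVertex v ↔ G.IsCutVertex v := by
  by_cases hv : G.Reachable x₂ v
  · rw [joinSets_comm]
    refine isCutVertex_joinSets_iff_aux h₂ h₁ (fun h => hx h.symm) fun h => hx (h.trans hv.symm)
  · exact isCutVertex_joinSets_iff_aux h₁ h₂ hx hv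

end Join

/-! ### Local structure of a maximal graph -/

section Maximal

variable {V : Type*} [Fintype V] {G : SimpleGraph V}

/-- `G` maximizes the signless Laplacian Estrada index among the graphs with the same vertex set and
the same number of cut vertices. -/
def IsMaxSLEE (G : SimpleGraph V) : Prop :=
  ∀ G' : SimpleGraph V, G'.cutVertexCount = G.cutVertexCount → G'.SLEE ≤ G.SLEE

theorem IsMaxSLEE.not_lt (hG : G.IsMaxSLEE) {G' : SimpleGraph V}
    (h : ∀ v, G'.IsCutVertex v ↔ G.IsCutVertex v) : ¬ G < G' :=
  fun hlt => (SLEE_lt_of_lt hlt).not_ge (hG G' (cutVertexCount_congr h))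

theorem IsMaxSLEE.connected [Nonempty V] (hG : G.IsMaxSLEE) : G.Connected := by
  refine ⟨fun x₁ x₂ => ?_⟩
  by_contra hx
  obtain ⟨U₁, h₁⟩ := G.exists_isAttachingSet x₁
  obtain ⟨U₂, h₂⟩ := G.exists_isAttachingSet x₂
  refine hG.not_lt (isCutVertex_joinSets_iff h₁ h₂ hx) (lt_of_le_not_ge (le_joinSets _) ?_)
  intro hle
  obtain ⟨u₁, hu₁⟩ := h₁.nonempty
  obtain ⟨u₂, hu₂⟩ := h₂.nonempty
  have : G.Adj u₁ u₂ := hle (Or.inr (Or.inl ⟨hu₁, hu₂⟩))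
  exact hx (((h₁.reachable hu₁).trans this.reachable).trans (h₂.reachable hu₂).symm)

/-- Two nonadjacent vertices of a maximal graph are separated by a vertex whose removal leaves just
two components. -/
theorem IsMaxSLEE.exists_separating (hG : G.IsMaxSLEE) (hc : G.Connected) {x y : V} (hxy : x ≠ y)
    (hadj : ¬ G.Adj x y) : ∃ v, v ≠ x ∧ v ≠ y ∧ ¬ G.ReachAvoid v x y ∧
      ∀ z, z ≠ v → G.ReachAvoid v x z ∨ G.ReachAvoid v y z := by
  have hdisj : Disjoint ({x} : Set V) {y} := by simpa using hxy
  have hlt : G < G.joinSets {x} {y} hdisj := by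
    refine lt_of_le_not_ge (le_joinSets _) fun hle => hadj (hle ?_)
    exact Or.inr (Or.inl ⟨rfl, rfl⟩)
  set G' := G.joinSets {x} {y} hdisj with hG'
  have hc' : G'.Connected := hc.mono hlt.le
  obtain ⟨v, hv⟩ : ∃ v, ¬ (G'.IsCutVertex v ↔ G.IsCutVertex v) := by
    by_contra! hcon
    exact hG.not_lt hcon hlt
  have hsub : ∀ p q, G'.Adj p q → G.Adj p q ∨ (p = x ∧ q = y) ∨ (p = y ∧ q = x) := fun p q h => h
  -- Otherwise deleting `v` would leave the same components in `G` and in `G'`, and the status of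
  -- `v` could not change.
  have hkey : ¬ (∀ p q, (G'.deleteIncidenceSet v).Adj p q → G.ReachAvoid v p q) := by
    intro hcon
    apply hv
    have hiff : ∀ p q, G'.ReachAvoid v p q ↔ G.ReachAvoid v p q := fun p q =>
      ⟨fun h => Reachable.of_adj_imp_reachable hcon h, fun h => h.mono hlt.le⟩
    constructor <;> intro h <;> obtain ⟨a, b, ha, hb, hab⟩ := isCutVertex_iff.1 h
    · rw [hiff] at hab
      exact .of_not_reachAvoid hc ha.ne' hb.ne' hab
    · rw [← hiff] at hab
      exact .of_not_reachAvoid hc' ha.ne' hb.ne' hab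
  have hx : v ≠ x ∧ v ≠ y ∧ ¬ G.ReachAvoid v x y := by
    by_contra! hcon
    apply hkey
    intro p q hpq
    rw [deleteIncidenceSet_adj] at hpq
    obtain ⟨h, hp, hq⟩ := hpq
    rcases hsub p q h with h | ⟨rfl, rfl⟩ | ⟨rfl, rfl⟩
    · exact h.reachAvoid hp hq
    · exact hcon hp.symm hq.symm
    · exact (hcon hq.symm hp.symm).symm
  refine ⟨v, hx.1, hx.2.1, hx.2.2, fun z hz => ?_⟩
  have hcut : G.IsCutVertex v := .of_not_reachAvoid hc hx.1.symm hx.2.1.symm hx.2.2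
  -- The single edge `xy` reconnects everything after the removal of `v`, so there were just two
  -- components.
  have hncut : ¬ G'.IsCutVertex v := by tauto
  have hz' : G'.ReachAvoid v x z :=
    reachAvoid_of_reachable (not_isCutVertex_iff.1 hncut) (hc' x z) hx.1.symm hz
  refine hz'.mem_of_closed (P := fun z => G.ReachAvoid v x z ∨ G.ReachAvoid v y z)
    (fun p q hpq hp => ?_) (Or.inl (Reachable.refl _))
  rw [deleteIncidenceSet_adj] at hpq
  obtain ⟨h, hpv, hqv⟩ := hpq
  rcases hsub p q h with h | ⟨-, rfl⟩ | ⟨-, rfl⟩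
  · exact hp.imp (fun hp => hp.trans (h.reachAvoid hpv hqv)) fun hp =>
      hp.trans (h.reachAvoid hpv hqv)
  · exact Or.inr (Reachable.refl _)
  · exact Or.inl (Reachable.refl _)

/-- The path `x v y` leaves `v` as the only possible separating vertex. -/
theorem IsMaxSLEE.adj_or_separated (hG : G.IsMaxSLEE) (hc : G.Connected) {v x y : V}
    (hx : G.Adj v x) (hy : G.Adj v y) (hxy : x ≠ y) :
    G.Adj x y ∨ (¬ G.ReachAvoid v x y ∧
      ∀ z, z ≠ v → G.ReachAvoid v x z ∨ G.ReachAvoid v y z) := by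
  by_contra! hcon
  obtain ⟨u, hux, huy, hsep, hall⟩ := hG.exists_separating hc hxy hcon.1
  have huv : u = v := by
    by_contra huv
    exact hsep ((hx.symm.reachAvoid hux.symm (Ne.symm huv)).trans
      (hy.reachAvoid (Ne.symm huv) huy.symm))
  subst huv
  obtain ⟨z, hz, h⟩ := hcon.2 hsep
  exact absurd (hall z hz) (by tauto)

theorem IsMaxSLEE.adj_of_reachAvoid (hG : G.IsMaxSLEE) (hc : G.Connected) {v x y : V}
    (hx : G.Adj v x) (hy : G.Adj v y) (hxy : x ≠ y) (h : G.ReachAvoid v x y) : G.Adj x y :=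
  (hG.adj_or_separated hc hx hy hxy).resolve_right fun h' => h'.1 h

theorem IsMaxSLEE.adj_of_not_isCutVertex (hG : G.IsMaxSLEE) (hc : G.Connected) {v x y : V}
    (hv : ¬ G.IsCutVertex v) (hx : G.Adj v x) (hy : G.Adj v y) (hxy : x ≠ y) : G.Adj x y :=
  hG.adj_of_reachAvoid hc hx hy hxy (not_isCutVertex_iff.1 hv x y hx hy)

/-- The vertex `v` lies in a triangle. -/
def InTriangle (G : SimpleGraph V) (v : V) : Prop := ∃ x y, G.Adj v x ∧ G.Adj v y ∧ G.Adj x y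

/-- Removing `v` leaves two components, so a third neighbour would share one with `x` or `y`, be
adjacent to it, and close a triangle at `v`. -/
theorem IsMaxSLEE.eq_or_eq_of_not_inTriangle (hG : G.IsMaxSLEE) (hc : G.Connected) {v x y z : V}
    (hv : ¬ G.InTriangle v) (hx : G.Adj v x) (hy : G.Adj v y) (hxy : x ≠ y) (hz : G.Adj v z) :
    z = x ∨ z = y := by
  by_contra! hcon
  have hnot : ∀ {a b}, G.Adj v a → G.Adj v b → ¬ G.Adj a b := fun ha hb hab => hv ⟨_, _, ha, hb, hab⟩
  have h1 := ((hG.adj_or_separated hc hx hy hxy).resolve_left (hnot hx hy)).2 z hz.ne'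
  rcases h1 with h1 | h1
  · exact hnot hx hz (hG.adj_of_reachAvoid hc hx hz hcon.1.symm h1)
  · exact hnot hy hz (hG.adj_of_reachAvoid hc hy hz hcon.2.symm h1)

theorem IsMaxSLEE.eq_of_not_inTriangle_of_not_isCutVertex (hG : G.IsMaxSLEE) (hc : G.Connected)
    {v x y : V} (hv : ¬ G.InTriangle v) (hcut : ¬ G.IsCutVertex v) (hx : G.Adj v x)
    (hy : G.Adj v y) : x = y := by
  by_contra hxy
  exact hv ⟨x, y, hx, hy, hG.adj_of_not_isCutVertex hc hcut hx hy hxy⟩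

end Maximal

/-! ### Shortest paths -/

section Geodesics

variable {V : Type*} {G : SimpleGraph V}

/-- `y 0, …, y L` is a shortest path. -/
structure IsGeodesic (G : SimpleGraph V) (y : ℕ → V) (L : ℕ) : Prop where
  adj : ∀ i < L, G.Adj (y i) (y (i + 1))
  dist_eq : ∀ i j, i ≤ j → j ≤ L → G.dist (y i) (y j) = j - i

theorem Connected.exists_isGeodesic (hc : G.Connected) (u v : V) :
    ∃ y : ℕ → V, y 0 = u ∧ y (G.dist u v) = v ∧ G.IsGeodesic y (G.dist u v) := by
  obtain ⟨p, hp⟩ := hc.exists_walk_length_eq_dist u v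
  have hadj : ∀ i < G.dist u v, G.Adj (p.getVert i) (p.getVert (i + 1)) := fun i hi =>
    p.adj_getVert_succ (hp ▸ hi)
  have hle : ∀ i d, i + d ≤ G.dist u v → G.dist (p.getVert i) (p.getVert (i + d)) ≤ d := by
    intro i d
    induction d with
    | zero => simp
    | succ d ih =>
      intro h
      have h1 := hc.dist_triangle (u := p.getVert i) (v := p.getVert (i + d))
        (w := p.getVert (i + (d + 1)))
      have h2 := dist_eq_one_iff_adj.2 (hadj (i + d) (by omega))
      have h3 := ih (by omega)
      rw [show i + (d + 1) = i + d + 1 by ring] at h1 ⊢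
      omega
  have h0 : p.getVert 0 = u := p.getVert_zero
  have hL : p.getVert (G.dist u v) = v := by rw [← hp]; exact p.getVert_length
  refine ⟨p.getVert, h0, hL, hadj, fun i j hij hj => ?_⟩
  have h1 := hle 0 i (by omega)
  have h2 := hle i (j - i) (by omega)
  have h3 := hle j (G.dist u v - j) (by omega)
  rw [show i + (j - i) = j by omega] at h2
  rw [show j + (G.dist u v - j) = G.dist u v by omega, hL] at h3
  rw [zero_add, h0] at h1
  have h4 := hc.dist_triangle (u := u) (v := p.getVert i) (w := v)
  have h5 := hc.dist_triangle (u := p.getVert i) (v := p.getVert j) (w := v)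
  omega

theorem IsGeodesic.eq_of_eq {y : ℕ → V} {L i j : ℕ} (hy : G.IsGeodesic y L) (hi : i ≤ L)
    (hj : j ≤ L) (h : y i = y j) : i = j := by
  rcases le_total i j with hij | hij
  · have := hy.dist_eq i j hij hj
    rw [h, dist_self] at this
    omega
  · have := hy.dist_eq j i hij hi
    rw [h, dist_self] at this
    omega

theorem IsGeodesic.reachAvoid {y : ℕ → V} {L : ℕ} (hy : G.IsGeodesic y L) {i : ℕ} (hi : 1 ≤ i)
    (hiL : i ≤ L) : G.ReachAvoid (y 0) (y i) (y L) := by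
  induction hiL using Nat.decreasingInduction with
  | self => exact Reachable.refl _
  | of_succ k hk ih =>
    refine ((hy.adj k hk).reachAvoid (fun h => ?_) fun h => ?_).trans (ih (by omega))
    · have := hy.eq_of_eq hk.le (by omega) h
      omega
    · have := hy.eq_of_eq (i := k + 1) hk (by omega) h
      omega

theorem IsMaxSLEE.geodesic_adj_iff [Fintype V] (hG : G.IsMaxSLEE) (hc : G.Connected) {y : ℕ → V}
    {L : ℕ} (hy : G.IsGeodesic y L) (hT : ∀ i, 1 ≤ i → i ≤ L → ¬ G.InTriangle (y i))
    (hcut : ¬ G.IsCutVertex (y L)) {i : ℕ} (hi : 1 ≤ i) (hiL : i ≤ L) (u : V) :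
    G.Adj (y i) u ↔ u = y (i - 1) ∨ (i < L ∧ u = y (i + 1)) := by
  have h1 : G.Adj (y i) (y (i - 1)) := by
    have := hy.adj (i - 1) (by omega)
    rw [show i - 1 + 1 = i by omega] at this
    exact this.symm
  constructor
  · intro hu
    rcases hiL.lt_or_eq with hlt | rfl
    · have hne : y (i - 1) ≠ y (i + 1) := fun h => by
        have := hy.eq_of_eq (by omega) (by omega) h
        omega
      exact (hG.eq_or_eq_of_not_inTriangle hc (hT i hi hiL) h1 (hy.adj i hlt) hne hu).imp id
        fun h => ⟨hlt, h⟩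
    · exact Or.inl (hG.eq_of_not_inTriangle_of_not_isCutVertex hc (hT i hi le_rfl) hcut hu h1)
  · rintro (rfl | ⟨h, rfl⟩)
    · exact h1
    · exact hy.adj i h

end Geodesics

/-! ### Pendent paths and the shift of a clique -/

section PendantPaths

variable {V : Type*} {G : SimpleGraph V} {B : Finset V}

/-- `b = p 0, …, p l` is a pendent path attached at the vertex `b` of the clique `B`. -/
structure IsPendantPath (G : SimpleGraph V) (B : Finset V) (b : V) (l : ℕ) (p : ℕ → V) :
    Prop where
  zero : p 0 = b
  adj_zero : ∀ u, G.Adj b u ↔ (u ∈ B ∧ u ≠ b) ∨ (0 < l ∧ u = p 1)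
  adj : ∀ i, 1 ≤ i → i ≤ l → ∀ u, G.Adj (p i) u ↔ u = p (i - 1) ∨ (i < l ∧ u = p (i + 1))
  notMem : ∀ i, 1 ≤ i → i ≤ l → p i ∉ B
  ne : ∀ i, i + 2 ≤ l → p i ≠ p (i + 2)

/-- A coincidence of two vertices is followed back along `p` towards the clique, where only base
points can agree. Following it forward along `p'` would force `p` to backtrack. -/
theorem IsPendantPath.eq_of_eq {b b' : V} {l l' : ℕ} {p p' : ℕ → V}
    (h : G.IsPendantPath B b l p) (h' : G.IsPendantPath B b' l' p') (hb : b ∈ B) (hb' : b' ∈ B)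
    (hpp : b = b' → p = p') : ∀ i ≤ l, ∀ j ≤ l', p i = p' j → b = b' ∧ i = j := by
  intro i
  induction i with
  | zero =>
    intro _ j hj heq
    rw [h.zero] at heq
    rcases Nat.eq_zero_or_pos j with rfl | hj0
    · rw [h'.zero] at heq
      exact ⟨heq, rfl⟩
    · exact absurd (heq ▸ hb) (h'.notMem j hj0 hj)
  | succ i ih =>
    intro hi j hj heq
    rcases Nat.eq_zero_or_pos j with rfl | hj0
    · rw [h'.zero] at heq
      exact absurd (heq ▸ hb') (h.notMem (i + 1) (by omega) hi)
    · have hadj : G.Adj (p (i + 1)) (p i) := (h.adj (i + 1) (by omega) hi _).2 (Or.inl rfl)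
      rw [heq, h'.adj j hj0 hj] at hadj
      rcases hadj with hadj | ⟨hjl, hadj⟩
      · obtain ⟨h1, h2⟩ := ih (by omega) (j - 1) (by omega) hadj
        exact ⟨h1, by omega⟩
      · obtain ⟨h1, h2⟩ := ih (by omega) (j + 1) (by omega) hadj
        have h3 := h.ne j (by omega)
        rw [hpp h1] at h3 heq
        rw [show i + 1 = j + 2 by omega] at heq
        exact absurd heq.symm h3

theorem isCutVertex_congr_of_reachAvoid [Finite V] {G' : SimpleGraph V} (hc : G.Connected)
    (hc' : G'.Connected) {v : V} (h : ∀ p q, G.ReachAvoid v p q ↔ G'.ReachAvoid v p q) :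
    G.IsCutVertex v ↔ G'.IsCutVertex v := by
  constructor <;> intro hv <;> obtain ⟨a, b, ha, hb, hab⟩ := isCutVertex_iff.1 hv
  · rw [h] at hab
    exact .of_not_reachAvoid hc' ha.ne' hb.ne' hab
  · rw [← h] at hab
    exact .of_not_reachAvoid hc ha.ne' hb.ne' hab

open Classical in
/-- In a maximal graph, the clique `B` cannot be shifted from the end `w` of the edge `c w` to the end
`y 1` of the edge `c (y 1)`, as soon as the pendent path at `w` is shorter than some nonbacktracking
walk through `c` and `y 1`. -/
theorem IsMaxSLEE.not_exists_longer_walk [Fintype V] (hG : G.IsMaxSLEE) (hc : G.Connected)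
    (hB : ∀ u ∈ B, ∀ v ∈ B, u ≠ v → G.Adj u v) (hcard : 3 ≤ B.card) {b c : V} {a : ℕ} {w y : ℕ → V}
    (hw : G.IsPendantPath B b a w) (hb : b ∈ B) (hcB : c ∈ B) (hcb : c ≠ b) (hy0 : y 0 = c)
    (hsep : ¬ G.ReachAvoid c (y 1) b) (hy : ∀ i ≤ a + 1, G.Adj (y i) (y (i + 1)))
    (hyne : ∀ i < a + 1, y i ≠ y (i + 2)) (hyb : ∀ i ≤ a + 2, y i ≠ b) : False := by
  set x := y 1 with hx
  -- The edges from `b` to `J` are moved to `x`; the edge `b c` stays, so that `b` and its path now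
  -- hang from `c`.
  set J : Finset V := (B.erase c).erase b with hJ
  have memJ : ∀ {j}, j ∈ J ↔ j ∈ B ∧ j ≠ c ∧ j ≠ b := by
    intro j
    simp only [hJ, Finset.mem_erase]
    tauto
  have hcx : G.Adj c x := by
    rw [← hy0]
    exact hy 0 (by omega)
  have hwB : ∀ i, 1 ≤ i → i ≤ a → w i ∉ B := hw.notMem
  have hinj : ∀ i ≤ a, ∀ j ≤ a, w i = w j → i = j := fun i hi j hj h =>
    (hw.eq_of_eq hw hb hb (fun _ => rfl) i hi j hj h).2
  have hwc : ∀ i ≤ a, w i ≠ c := by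
    intro i hi h
    rcases Nat.eq_zero_or_pos i with rfl | h0
    · exact hcb (h ▸ hw.zero)
    · exact hwB i h0 hi (h ▸ hcB)
  have hwJ : ∀ i ≤ a, w i ∉ J := by
    intro i hi h
    rw [memJ] at h
    rcases Nat.eq_zero_or_pos i with rfl | h0
    · exact h.2.2 hw.zero
    · exact hwB i h0 hi h.1
  have hreachJ : ∀ j ∈ J, G.ReachAvoid c b j := fun j hj =>
    (hB b hb j (memJ.1 hj).1 (memJ.1 hj).2.2.symm).reachAvoid hcb.symm (memJ.1 hj).2.1
  have hxJ : x ∉ J := fun h => hsep (hreachJ x h).symm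
  have hxJ' : ∀ j ∈ J, ¬ G.Adj x j := fun j hj h => hsep
    ((h.reachAvoid hcx.ne' (memJ.1 hj).2.1).trans (hreachJ j hj).symm)
  have hreachw : ∀ i ≤ a, G.ReachAvoid c b (w i) := by
    intro i
    induction i with
    | zero => intro _; rw [hw.zero]
    | succ i ih =>
      intro hi
      refine (ih (by omega)).trans (Adj.reachAvoid ?_ (hwc i (by omega)) (hwc _ hi))
      exact ((hw.adj (i + 1) (by omega) hi _).2 (Or.inl rfl)).symm
  have hxw : ∀ i ≤ a, x ≠ w i := fun i hi h => hsep (h ▸ (hreachw i hi).symm)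
  obtain ⟨H, hH⟩ : ∃ H : SimpleGraph V, ∀ {u v}, H.Adj u v ↔
      G.Adj u v ∧ ¬ (u = b ∧ v ∈ J) ∧ ¬ (v = b ∧ u ∈ J) :=
    ⟨{ Adj := fun u v => G.Adj u v ∧ ¬ (u = b ∧ v ∈ J) ∧ ¬ (v = b ∧ u ∈ J)
       symm := ⟨fun u v h => ⟨h.1.symm, h.2.2, h.2.1⟩⟩
       loopless := ⟨fun u h => G.irrefl h.1⟩ }, Iff.rfl⟩
  let G' : SimpleGraph V :=
    { Adj := fun u v => H.Adj u v ∨ (u = x ∧ v ∈ J) ∨ (v = x ∧ u ∈ J)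
      symm := ⟨fun u v h => h.imp (fun h => h.symm) fun h => h.symm⟩
      loopless := ⟨fun u h => by
        rcases h with h | ⟨rfl, h⟩ | ⟨rfl, h⟩
        exacts [H.irrefl h, hxJ h, hxJ h]⟩ }
  have hG' : ∀ u v, G'.Adj u v ↔ H.Adj u v ∨ (u = x ∧ v ∈ J) ∨ (v = x ∧ u ∈ J) := fun _ _ => Iff.rfl
  have hbJ : b ∉ J := fun h => (memJ.1 h).2.2 rfl
  have hcJ : c ∉ J := fun h => (memJ.1 h).2.1 rfl
  have hGH : ∀ u v, G.Adj u v ↔ H.Adj u v ∨ (u = b ∧ v ∈ J) ∨ (v = b ∧ u ∈ J) := by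
    intro u v
    rw [hH]
    constructor
    · tauto
    · rintro (h | ⟨rfl, h⟩ | ⟨rfl, h⟩)
      · exact h.1
      · exact hB _ hb _ (memJ.1 h).1 (memJ.1 h).2.2.symm
      · exact hB _ (memJ.1 h).1 _ hb (memJ.1 h).2.2
  have hHbc : H.Adj b c := hH.2 ⟨hB b hb c hcB hcb.symm, fun h => hcJ h.2, fun h => hcb h.1⟩
  have hHcJ : ∀ j ∈ J, H.Adj c j := fun j hj =>
    hH.2 ⟨hB c hcB j (memJ.1 hj).1 (memJ.1 hj).2.1.symm, fun h => hcb h.1, fun h => hcJ h.2⟩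
  have hHcx : H.Adj c x := hH.2 ⟨hcx, fun h => hcb h.1, fun h => hcJ h.2⟩
  have hHw : ∀ i ≤ a, ∀ u, H.Adj (w i) u ↔
      (if i = 0 then u = c else u = w (i - 1)) ∨ (i < a ∧ u = w (i + 1)) := by
    intro i hi u
    rw [hH]
    rcases Nat.eq_zero_or_pos i with rfl | h0
    · rw [hw.zero, hw.adj_zero, if_pos rfl, zero_add]
      constructor
      · rintro ⟨h1 | h1, h2, h3⟩
        · left
          by_contra huc
          exact h2 ⟨rfl, memJ.2 ⟨h1.1, huc, h1.2⟩⟩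
        · exact Or.inr h1
      · rintro (rfl | ⟨h, rfl⟩)
        · exact ⟨Or.inl ⟨hcB, hcb⟩, fun h => hcJ h.2, fun h => hcb h.1⟩
        · exact ⟨Or.inr ⟨h, rfl⟩, fun h' => hwJ 1 h h'.2, fun h' => hbJ h'.2⟩
    · rw [hw.adj i h0 hi, if_neg (by omega)]
      refine and_iff_left ⟨fun h => ?_, fun h => hwJ i hi h.2⟩
      exact hwB i h0 hi (h.1 ▸ hb)
  -- the cut vertices are unchanged
  have key1 : ∀ v, v ≠ c → ∀ p q, G.Adj p q → p ≠ v → q ≠ v → G'.ReachAvoid v p q := by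
    intro v hv p q hpq hp hq
    rcases (hGH p q).1 hpq with h | ⟨rfl, h⟩ | ⟨rfl, h⟩
    · exact Adj.reachAvoid (Or.inl h) hp hq
    · exact (Adj.reachAvoid (Or.inl hHbc) hp hv.symm).trans
        (Adj.reachAvoid (Or.inl (hHcJ _ h)) hv.symm hq)
    · exact (Adj.reachAvoid (Or.inl (hHcJ _ h).symm) hp hv.symm).trans
        (Adj.reachAvoid (Or.inl hHbc.symm) hv.symm hq)
  have key2 : ∀ v, v ≠ c → ∀ p q, G'.Adj p q → p ≠ v → q ≠ v → G.ReachAvoid v p q := by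
    intro v hv p q hpq hp hq
    rcases hpq with h | ⟨rfl, h⟩ | ⟨rfl, h⟩
    · exact Adj.reachAvoid (hH.1 h).1 hp hq
    · exact (Adj.reachAvoid hcx.symm hp hv.symm).trans
        (Adj.reachAvoid (hH.1 (hHcJ _ h)).1 hv.symm hq)
    · exact (Adj.reachAvoid (hH.1 (hHcJ _ h)).1.symm hp hv.symm).trans
        (Adj.reachAvoid hcx hv.symm hq)
  have hc' : G'.Connected := by
    have := hc.nonempty
    refine ⟨fun p q => Reachable.of_adj_imp_reachable (fun u v h => ?_) (hc p q)⟩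
    rcases (hGH u v).1 h with h | ⟨rfl, h⟩ | ⟨rfl, h⟩
    · exact Adj.reachable (Or.inl h)
    · exact (Adj.reachable (Or.inl hHbc)).trans (Adj.reachable (Or.inl (hHcJ _ h)))
    · exact (Adj.reachable (Or.inl (hHcJ _ h).symm)).trans (Adj.reachable (Or.inl hHbc.symm))
  have hcut : ∀ v, G'.IsCutVertex v ↔ G.IsCutVertex v := by
    intro v
    by_cases hv : v = c
    · subst hv
      refine iff_of_true (isCutVertex_iff.2 ⟨b, x, Or.inl hHbc.symm, Or.inl hHcx, fun hcon => ?_⟩)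
        (.of_not_reachAvoid hc hcx.ne' hcb.symm hsep)
      -- In `G'` the pendent path, including `b`, is attached to the rest only through `c`, so `c`
      -- still separates `b` from `x`.
      have hclosed : ∀ p q, (G'.deleteIncidenceSet v).Adj p q → (∃ i ≤ a, p = w i) →
          ∃ i ≤ a, q = w i := by
        rintro p q hpq ⟨i, hi, rfl⟩
        rw [deleteIncidenceSet_adj] at hpq
        obtain ⟨h | ⟨h, -⟩ | ⟨-, h⟩, -, hq⟩ := hpq
        · rcases (hHw i hi q).1 h with h | h
          · split_ifs at h with hi0
            · exact absurd h hq
            · exact ⟨i - 1, by omega, h⟩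
          · exact ⟨i + 1, h.1, h.2⟩
        · exact absurd h.symm (hxw i hi)
        · exact absurd h (hwJ i hi)
      obtain ⟨i, hi, h⟩ := hcon.mem_of_closed (P := fun z => ∃ i ≤ a, z = w i) hclosed
        ⟨0, by omega, hw.zero.symm⟩
      exact hxw i hi h
    · refine isCutVertex_congr_of_reachAvoid hc' hc fun p q => ⟨fun h => ?_, fun h => ?_⟩
      · refine Reachable.of_adj_imp_reachable (fun p q h => ?_) h
        rw [deleteIncidenceSet_adj] at h
        exact key2 v hv p q h.1 h.2.1 h.2.2
      · refine Reachable.of_adj_imp_reachable (fun p q h => ?_) h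
        rw [deleteIncidenceSet_adj] at h
        exact key1 v hv p q h.1 h.2.1 h.2.2
  -- the walks of `H` issuing from `b` are dominated by those issuing from `x`
  obtain ⟨w', hw'0, hw's⟩ : ∃ w' : ℕ → V, w' 0 = c ∧ ∀ i, w' (i + 1) = w i :=
    ⟨fun i => Nat.casesOn i c w, rfl, fun _ => rfl⟩
  have hN : ∀ i, 1 ≤ i → i ≤ a + 1 → ∀ u, H.Adj (w' i) u ↔
      u = w' (i - 1) ∨ (i < a + 1 ∧ u = w' (i + 1)) := by
    intro i hi1 hia u
    obtain ⟨i, rfl⟩ : ∃ k, i = k + 1 := ⟨i - 1, by omega⟩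
    rw [hw's, hw's, hHw i (by omega), Nat.add_sub_cancel, add_lt_add_iff_right]
    cases i with
    | zero => rw [if_pos rfl, hw'0]
    | succ i => rw [if_neg (by omega), hw's, Nat.add_sub_cancel]
  have hw'inj : ∀ i ≤ a + 1, ∀ j ≤ a + 1, w' i = w' j → i = j := by
    intro i hi j hj h
    cases i <;> cases j
    · rfl
    · rw [hw'0, hw's] at h
      exact absurd h.symm (hwc _ (by omega))
    · rw [hw'0, hw's] at h
      exact absurd h (hwc _ (by omega))
    · rw [hw's, hw's] at h
      rw [hinj _ (by omega) _ (by omega) h]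
  have hne : ∀ i, i + 2 ≤ a + 1 → w' i ≠ w' (i + 2) := by
    intro i hi h
    have := hw'inj i (by omega) _ hi h
    omega
  have hyH : ∀ i ≤ a + 1, H.Adj (y i) (y (i + 1)) := fun i hi =>
    hH.2 ⟨hy i hi, fun h => hyb i (by omega) h.1, fun h => hyb (i + 1) (by omega) h.1⟩
  have h01 : w' 0 = y 0 := by rw [hw'0, hy0]
  have hw'1 : w' 1 = b := by rw [hw's, hw.zero]
  have hJne : J.Nonempty := by
    rw [← Finset.card_pos, hJ, Finset.card_erase_of_mem (Finset.mem_erase.2 ⟨hcb.symm, hb⟩),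
      Finset.card_erase_of_mem hcB]
    omega
  refine absurd (hG G' (cutVertexCount_congr hcut)) (not_le.2 ?_)
  refine SLEE_lt_of_star_move (H := H) (G := G) (G' := G') hJne hbJ hxJ (fun j hj h => (hH.1 h).2.1 ⟨rfl, hj⟩)
    (fun j hj h => hxJ' j hj (hH.1 h).1) hGH hG' (fun k => ?_) (fun k j hj => ?_) ?_
  · have := pow_apply_path_path_le_walk_walk h01 hN hne hyH hyne hw'inj k 1 (by omega) 1 (by omega)
    rwa [hw'1, ← hx] at this
  · have := pow_apply_path_le_walk (z := j) h01 hN hne hyH hyne (fun i hi hia h => ?_) k 1 (by omega)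
    · rwa [hw'1, ← hx] at this
    · obtain ⟨i, rfl⟩ : ∃ k, i = k + 1 := ⟨i - 1, by omega⟩
      rw [hw's] at h
      exact hwJ i (by omega) (h ▸ hj)
  · have := exists_pow_apply_path_lt_walk h01 hN hne hyH hyne hw'inj (by omega)
    rwa [hw'1, ← hx] at this

end PendantPaths

/-! ### Global structure of a maximal graph -/

section Structure

variable {V : Type*} [Fintype V] {G : SimpleGraph V}

/-- In a maximal graph, a vertex of a branch at `c` farthest from `c` is not a cut vertex. -/
theorem Connected.not_isCutVertex_of_farthest (hc : G.Connected) {c b x e : V} (hcb : G.Adj c b)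
    (hx : ¬ G.ReachAvoid c x b)
    (hall : ∀ z, z ≠ c → G.ReachAvoid c x z ∨ G.ReachAvoid c b z) (hec : e ≠ c)
    (he : G.ReachAvoid c x e)
    (hmax : ∀ z, z ≠ c → G.ReachAvoid c x z → G.dist c z ≤ G.dist c e) : ¬ G.IsCutVertex e := by
  have hsep : ∀ z, G.ReachAvoid c b z → ¬ G.ReachAvoid c x z := fun z h1 h2 =>
    hx (h2.trans h1.symm)
  have h1 : ∀ z, G.ReachAvoid c b z → G.ReachAvoid e c z := by
    intro z hz
    refine (hz.mem_of_closed (P := fun z => G.ReachAvoid c b z ∧ G.ReachAvoid e c z)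
      (fun p q hpq hp => ?_) ⟨Reachable.refl _, ?_⟩).2
    · have hq : G.ReachAvoid c b q := hp.1.trans hpq.reachable
      refine ⟨hq, hp.2.trans ((deleteIncidenceSet_adj.1 hpq).1.reachAvoid ?_ ?_)⟩
      · rintro rfl
        exact hsep _ hp.1 he
      · rintro rfl
        exact hsep _ hq he
    · refine hcb.reachAvoid hec.symm ?_
      rintro rfl
      exact hx he
  -- The predecessor of `z` on a geodesic from `c` is closer to `c` than `z`, hence closer than `e`,
  -- and so differs from `e`.
  have h2 : ∀ d, ∀ z, z ≠ c → z ≠ e → G.ReachAvoid c x z → G.dist c z = d →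
      G.ReachAvoid e c z := by
    intro d
    induction d using Nat.strong_induction_on with
    | _ d ih =>
      intro z hzc hze hz hd
      obtain ⟨y, hy0, hyd, hy⟩ := hc.exists_isGeodesic c z
      have hpos := hc.pos_dist_of_ne hzc.symm
      have hadj := hy.adj (G.dist c z - 1) (by omega)
      rw [show G.dist c z - 1 + 1 = G.dist c z by omega, hyd] at hadj
      have hdist := hy.dist_eq 0 (G.dist c z - 1) (by omega) (by omega)
      rw [hy0] at hdist
      set z' := y (G.dist c z - 1)
      by_cases hz'c : z' = c
      · rw [hz'c] at hadj
        exact hadj.reachAvoid hec.symm hze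
      · have hz' : G.ReachAvoid c x z' := hz.trans (hadj.symm.reachAvoid hzc hz'c)
        have hz'e : z' ≠ e := by
          intro h
          have := hmax z hzc hz
          rw [h] at hdist
          omega
        exact (ih _ (by omega) z' hz'c hz'e hz' hdist).trans (hadj.reachAvoid hz'e hze)
  have h3 : ∀ z, z ≠ e → G.ReachAvoid e c z := by
    intro z hze
    by_cases hzc : z = c
    · rw [hzc]
    · exact (hall z hzc).elim (fun h => h2 _ z hzc hze h rfl) (h1 z)
  rw [not_isCutVertex_iff]
  intro p q hp hq
  exact (h3 p hp.ne').symm.trans (h3 q hq.ne')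

omit [Fintype V] in
/-- A shortest path ending in a triangle can be prolonged to an infinite nonbacktracking walk circling
around the triangle. -/
theorem IsGeodesic.exists_circling_walk {y : ℕ → V} {d : ℕ} (hy : G.IsGeodesic y d)
    (hT : G.InTriangle (y d)) : ∃ Y : ℕ → V, (∀ i ≤ d, Y i = y i) ∧
      (∀ i, d < i → Y i = y d ∨ G.Adj (y d) (Y i)) ∧ (∀ i, G.Adj (Y i) (Y (i + 1))) ∧
      ∀ i, Y i ≠ Y (i + 2) := by
  -- The triangle is oriented so that its first step does not return to `y (d - 1)`.
  obtain ⟨u, u', hu, hu', huu', hne⟩ : ∃ u u', G.Adj (y d) u ∧ G.Adj (y d) u' ∧ G.Adj u u' ∧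
      (1 ≤ d → y (d - 1) ≠ u) := by
    obtain ⟨u, u', hu, hu', huu'⟩ := hT
    by_cases h : y (d - 1) = u
    · exact ⟨u', u, hu', hu, huu'.symm, fun _ h' => huu'.ne (h.symm.trans h')⟩
    · exact ⟨u, u', hu, hu', huu', fun _ => h⟩
  let Z : ℕ → V := fun k => if k % 3 = 0 then y d else if k % 3 = 1 then u else u'
  have hZ : ∀ k, G.Adj (Z k) (Z (k + 1)) ∧ Z k ≠ Z (k + 2) ∧ (Z k = y d ∨ G.Adj (y d) (Z k)) := by
    intro k
    have h3 : k % 3 = 0 ∨ k % 3 = 1 ∨ k % 3 = 2 := by omega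
    rcases h3 with h | h | h
    · have h1 : (k + 1) % 3 = 1 := by omega
      have h2 : (k + 2) % 3 = 2 := by omega
      simp only [Z, h, h1, h2]
      exact ⟨hu, hu'.ne, Or.inl rfl⟩
    · have h1 : (k + 1) % 3 = 2 := by omega
      have h2 : (k + 2) % 3 = 0 := by omega
      simp only [Z, h, h1, h2]
      exact ⟨huu', hu.ne', Or.inr hu⟩
    · have h1 : (k + 1) % 3 = 0 := by omega
      have h2 : (k + 2) % 3 = 1 := by omega
      simp only [Z, h, h1, h2]
      exact ⟨hu'.symm, huu'.ne', Or.inr hu'⟩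
  have hZ0 : Z 0 = y d := rfl
  have hZ1 : Z 1 = u := rfl
  have hlow : ∀ i ≤ d, (fun i => if i ≤ d then y i else Z (i - d)) i = y i := fun i hi => if_pos hi
  have hhigh : ∀ i, d ≤ i → (fun i => if i ≤ d then y i else Z (i - d)) i = Z (i - d) := by
    intro i hi
    dsimp only
    split_ifs with h
    · obtain rfl := le_antisymm h hi
      rw [Nat.sub_self, hZ0]
    · rfl
  generalize (fun i => if i ≤ d then y i else Z (i - d)) = Y at hlow hhigh
  refine ⟨Y, hlow, fun i hi => ?_, fun i => ?_, fun i => ?_⟩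
  · rw [hhigh i hi.le]
    exact (hZ _).2.2
  · rcases lt_or_ge i d with hi | hi
    · rw [hlow i hi.le, hlow (i + 1) hi]
      exact hy.adj i hi
    · rw [hhigh i hi, hhigh (i + 1) (by omega), Nat.sub_add_comm hi]
      exact (hZ _).1
  · rcases lt_or_ge (i + 1) d with hi | hi
    · rw [hlow i (by omega), hlow (i + 2) hi]
      intro h
      have := hy.eq_of_eq (by omega) (by omega) h
      omega
    · rcases lt_or_ge i d with hi' | hi'
      · rw [hlow i hi'.le, hhigh (i + 2) (by omega), show i + 2 - d = 1 by omega, hZ1,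
          show i = d - 1 by omega]
        exact hne (by omega)
      · rw [hhigh i hi', hhigh (i + 2) (by omega), Nat.sub_add_comm hi']
        exact (hZ _).2.1

variable {B : Finset V} {a : ℕ} {w : ℕ → V} {b : V}

/-- Each branch of a maximal graph at the clique `B` is a pendent path, about as long as a shortest
such path. -/
theorem IsMaxSLEE.exists_isPendantPath (hG : G.IsMaxSLEE) (hc : G.Connected)
    (hB : ∀ u ∈ B, ∀ v ∈ B, u ≠ v → G.Adj u v) (hcard : 3 ≤ B.card)
    (hw : G.IsPendantPath B b a w) (hb : b ∈ B)
    (hmin : ∀ e t, ¬ G.IsCutVertex e → G.InTriangle t → a ≤ G.dist t e)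
    (hBT : ∀ u ∈ B, G.InTriangle u) (hwT : ∀ i, 1 ≤ i → i ≤ a → ¬ G.InTriangle (w i))
    {c : V} (hcB : c ∈ B) (hcb : c ≠ b) :
    ∃ l p, (l = a ∨ l = a + 1) ∧ G.IsPendantPath B c l p := by
  by_cases hN : ∀ u, G.Adj c u → u ∈ B
  · have hncut : ¬ G.IsCutVertex c := not_isCutVertex_of_clique fun x y hx hy hxy =>
      hB x (hN x hx) y (hN y hy) hxy
    have ha : a = 0 := by
      have := hmin c c hncut (hBT c hcB)
      rw [dist_self] at this
      omega
    refine ⟨0, fun _ => c, Or.inl ha.symm, rfl, fun u => ?_, ?_, ?_, ?_⟩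
    · constructor
      · exact fun h => Or.inl ⟨hN u h, h.ne'⟩
      · rintro (h | h)
        · exact hB c hcB u h.1 h.2.symm
        · exact absurd h.1 (lt_irrefl _)
    all_goals intros; omega
  · push Not at hN
    obtain ⟨x, hcx, hxB⟩ := hN
    have hadjcb : G.Adj c b := hB c hcB b hb hcb
    -- A neighbour of `b` outside `B` is `w 1`, which lies in no triangle, so `u` is not adjacent to
    -- `b`.
    have hout : ∀ u, G.Adj c u → u ∉ B → ¬ G.ReachAvoid c u b ∧
        ∀ z, z ≠ c → G.ReachAvoid c u z ∨ G.ReachAvoid c b z := by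
      intro u hu huB
      refine (hG.adj_or_separated hc hu hadjcb fun h => huB (h ▸ hb)).resolve_left fun h => ?_
      rcases (hw.adj_zero u).1 h.symm with h1 | ⟨h1, rfl⟩
      · exact huB h1.1
      · exact hwT 1 le_rfl h1 ⟨c, b, hu.symm, h, hadjcb⟩
    obtain ⟨hsep, hall⟩ := hout x hcx hxB
    have hXB : ∀ z ∈ B, z ≠ c → ¬ G.ReachAvoid c x z := by
      intro z hz hzc h
      apply hsep
      rcases eq_or_ne z b with rfl | hzb
      · exact h
      · exact h.trans ((hB z hz b hb hzb).reachAvoid hzc hcb.symm)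
    have hXb : ∀ z, G.ReachAvoid c x z → z ≠ b := fun z hz h => hXB b hb hcb.symm (h ▸ hz)
    -- shortest paths from `c` into the branch of `x` stay in this branch
    have hgeo : ∀ {y : ℕ → V} {L : ℕ}, G.IsGeodesic y L → y 0 = c → G.ReachAvoid c x (y L) →
        ∀ i, 1 ≤ i → i ≤ L → G.ReachAvoid c x (y i) := by
      intro y L hy hy0 hyL i hi hiL
      have := hy.reachAvoid hi hiL
      rw [hy0] at this
      exact hyL.trans this.symm
    -- A triangle in the branch supplies nonbacktracking walks of any length, which the clique shift
    -- excludes.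
    by_cases hXT : ∃ t, G.ReachAvoid c x t ∧ G.InTriangle t
    · exfalso
      obtain ⟨t, hxt, htT⟩ := hXT
      have htc : t ≠ c := hxt.ne hcx.ne'
      obtain ⟨y, hy0, hyd, hy⟩ := hc.exists_isGeodesic c t
      set d := G.dist c t with hd
      have hdpos : 0 < d := hc.pos_dist_of_ne htc.symm
      obtain ⟨Y, hYlow, hYhigh, hYadj, hYne⟩ := hy.exists_circling_walk (hyd ▸ htT)
      have hX := hgeo hy hy0 (hyd ▸ hxt)
      refine hG.not_exists_longer_walk hc hB hcard hw hb hcB hcb (y := Y)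
        (by rw [hYlow 0 (by omega), hy0]) ?_ (fun i _ => hYadj i) (fun i _ => hYne i) ?_
      · rw [hYlow 1 hdpos]
        exact fun h => hsep ((hX 1 le_rfl hdpos).trans h)
      · intro i _
        rcases le_or_gt i d with hi | hi
        · rw [hYlow i hi]
          rcases Nat.eq_zero_or_pos i with rfl | h0
          · rwa [hy0]
          · exact hXb _ (hX i h0 hi)
        · rcases hYhigh i hi with h | h
          · rw [h]
            exact hXb _ (hX d hdpos le_rfl)
          · rw [hyd] at h
            by_cases hYc : Y i = c
            · rwa [hYc]
            · exact hXb _ (hxt.trans (h.reachAvoid htc hYc))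
    · push Not at hXT
      -- A farthest vertex is not a cut vertex, so `a ≤ L` by minimality; the clique shift gives `L
      -- ≤ a + 1`.
      obtain ⟨e, ⟨hec, he⟩, hmax⟩ := Set.exists_max_image {z | z ≠ c ∧ G.ReachAvoid c x z}
        (fun z => G.dist c z) (Set.toFinite _) ⟨x, hcx.ne', Reachable.refl _⟩
      have hecut : ¬ G.IsCutVertex e :=
        hc.not_isCutVertex_of_farthest hadjcb hsep hall hec he fun z h1 h2 => hmax z ⟨h1, h2⟩
      obtain ⟨y, hy0, hyL, hy⟩ := hc.exists_isGeodesic c e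
      have haL := hmin e c hecut (hBT c hcB)
      have hLpos : 0 < G.dist c e := hc.pos_dist_of_ne hec.symm
      generalize G.dist c e = L at hyL hy haL hLpos
      have hX := hgeo hy hy0 (hyL ▸ he)
      have hne : ∀ i, i + 2 ≤ L → y i ≠ y (i + 2) := by
        intro i hi h
        have := hy.eq_of_eq (by omega) hi h
        omega
      have hLa : L ≤ a + 1 := by
        by_contra! hLa
        refine hG.not_exists_longer_walk hc hB hcard hw hb hcB hcb (y := y) hy0
          (fun h => hsep ((hX 1 le_rfl hLpos).trans h)) (fun i hi => hy.adj i (by omega))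
          (fun i hi => hne i (by omega)) fun i hi => ?_
        rcases Nat.eq_zero_or_pos i with rfl | h0
        · rwa [hy0]
        · exact hXb _ (hX i h0 (by omega))
      have hcy : G.Adj c (y 1) := hy0 ▸ hy.adj 0 hLpos
      have hX1 := hX 1 le_rfl hLpos
      refine ⟨L, y, by omega, hy0, fun u => ?_, fun i hi hiL u => ?_, fun i hi hiL h => ?_, hne⟩
      · constructor
        · intro hu
          by_cases huB : u ∈ B
          · exact Or.inl ⟨huB, hu.ne'⟩
          · refine Or.inr ⟨hLpos, ?_⟩
            obtain ⟨-, h2⟩ := hout u hu huB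
            rcases h2 (y 1) hcy.ne' with h | h
            · by_contra hne
              exact hXT _ hX1 ⟨c, u, hcy.symm, (hG.adj_of_reachAvoid hc hu hcy hne h).symm, hu⟩
            · exact absurd (hX1.trans h.symm) hsep
        · rintro (h | ⟨-, rfl⟩)
          · exact hB c hcB u h.1 h.2.symm
          · exact hcy
      · exact hG.geodesic_adj_iff hc hy (fun i hi hiL => hXT _ (hX i hi hiL)) (hyL ▸ hecut) hi hiL u
      · refine hXB _ h (fun h' => ?_) (hX i hi hiL)
        have := hy.eq_of_eq hiL (Nat.zero_le _) (h'.trans hy0.symm)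
        omega

/-- `G` is made up of a clique `B` and pendent paths attached at the vertices of `B`, the lengths of
which differ by at most one. -/
def IsCliqueWithBalancedPaths (G : SimpleGraph V) (B : Finset V) (a : ℕ) : Prop :=
  2 ≤ B.card ∧ (∀ u ∈ B, ∀ v ∈ B, u ≠ v → G.Adj u v) ∧
    ∀ c ∈ B, ∃ l p, (l = a ∨ l = a + 1) ∧ G.IsPendantPath B c l p

open Classical in
theorem IsMaxSLEE.exists_clique_of_inTriangle (hG : G.IsMaxSLEE) (hc : G.Connected) {e t : V}
    (he : ¬ G.IsCutVertex e) (ht : G.InTriangle t) :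
    ∃ B a, G.IsCliqueWithBalancedPaths B a := by
  -- A closest pair is chosen, so the geodesic from `b` to `e` meets no triangle after `b`.
  have hex : ∃ d, ∃ e t, ¬ G.IsCutVertex e ∧ G.InTriangle t ∧ G.dist t e = d :=
    ⟨_, e, t, he, ht, rfl⟩
  obtain ⟨e, b, he, hbT, hbe⟩ := Nat.find_spec hex
  have hmin : ∀ e t, ¬ G.IsCutVertex e → G.InTriangle t → Nat.find hex ≤ G.dist t e :=
    fun e t he ht => Nat.find_min' hex ⟨e, t, he, ht, rfl⟩
  generalize Nat.find hex = a at hbe hmin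
  obtain ⟨w, hw0, hwa, hw⟩ := hc.exists_isGeodesic b e
  rw [hbe] at hwa hw
  have hwT : ∀ i, 1 ≤ i → i ≤ a → ¬ G.InTriangle (w i) := by
    intro i hi hia hT
    have h1 := hmin e (w i) he hT
    have h2 := hw.dist_eq i a hia le_rfl
    rw [hwa] at h2
    omega
  have hbw : 0 < a → G.Adj b (w 1) := fun h => hw0 ▸ hw.adj 0 h
  -- For `a = 0` the value `w 1` has no meaning and nothing is excluded; then `b = e` is not a cut
  -- vertex.
  set C : Finset V := Finset.univ.filter fun u => G.Adj b u ∧ ¬ (0 < a ∧ u = w 1) with hC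
  have memC : ∀ {u}, u ∈ C ↔ G.Adj b u ∧ ¬ (0 < a ∧ u = w 1) := by
    intro u
    simp [hC]
  have hbC : b ∉ C := fun h => G.irrefl (memC.1 h).1
  have hCclique : ∀ u ∈ C, ∀ v ∈ C, u ≠ v → G.Adj u v := by
    intro u hu v hv huv
    rw [memC] at hu hv
    rcases Nat.eq_zero_or_pos a with ha | ha
    · refine hG.adj_of_not_isCutVertex hc ?_ hu.1 hv.1 huv
      rw [← hw0, ← ha, hwa]
      exact he
    -- If `b` separated `u` from `v`, one of them would share a component with `w 1`, putting `w 1`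
    -- in a triangle.
    · refine (hG.adj_or_separated hc hu.1 hv.1 huv).resolve_right fun h => ?_
      have hw1 : ∀ z, G.Adj b z → z ≠ w 1 → ¬ G.ReachAvoid b z (w 1) := fun z hz hz1 h =>
        hwT 1 le_rfl ha ⟨b, z, (hbw ha).symm,
          (hG.adj_of_reachAvoid hc hz (hbw ha) hz1 h).symm, hz⟩
      rcases h.2 (w 1) (hbw ha).ne' with h | h
      · exact hw1 u hu.1 (fun h' => hu.2 ⟨ha, h'⟩) h
      · exact hw1 v hv.1 (fun h' => hv.2 ⟨ha, h'⟩) h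
  have hB : ∀ u ∈ insert b C, ∀ v ∈ insert b C, u ≠ v → G.Adj u v := by
    intro u hu v hv huv
    rw [Finset.mem_insert] at hu hv
    rcases hu with rfl | hu <;> rcases hv with rfl | hv
    · exact absurd rfl huv
    · exact (memC.1 hv).1
    · exact (memC.1 hu).1.symm
    · exact hCclique u hu v hv huv
  obtain ⟨u, u', hu, hu', huu'⟩ := id hbT
  have hTC : ∀ z, G.Adj b z → G.InTriangle z → z ∈ C := fun z hz hzT =>
    memC.2 ⟨hz, fun h => hwT 1 le_rfl h.1 (h.2 ▸ hzT)⟩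
  have huC : u ∈ C := hTC u hu ⟨b, u', hu.symm, huu', hu'⟩
  have hu'C : u' ∈ C := hTC u' hu' ⟨b, u, hu'.symm, huu'.symm, hu⟩
  have hcard : 3 ≤ (insert b C).card := by
    rw [Finset.card_insert_of_notMem hbC]
    have := Finset.card_le_card (s := {u, u'}) (t := C) (by grind)
    rw [Finset.card_pair huu'.ne] at this
    omega
  have hBT : ∀ z ∈ insert b C, G.InTriangle z := by
    intro z hz
    rw [Finset.mem_insert] at hz
    rcases hz with rfl | hz
    · exact hbT
    · rcases eq_or_ne z u with rfl | hzu
      · exact ⟨b, u', hu.symm, huu', hu'⟩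
      · exact ⟨b, u, (memC.1 hz).1.symm, hCclique z hz u huC hzu, hu⟩
  have hpath : G.IsPendantPath (insert b C) b a w := by
    refine ⟨hw0, fun z => ?_, fun i hi hia z => ?_, fun i hi hia h => ?_, fun i hi h => ?_⟩
    · constructor
      · intro hz
        by_cases h : 0 < a ∧ z = w 1
        · exact Or.inr h
        · exact Or.inl ⟨Finset.mem_insert_of_mem (memC.2 ⟨hz, h⟩), hz.ne'⟩
      · rintro (⟨h1, h2⟩ | ⟨h, rfl⟩)
        · exact hB b (Finset.mem_insert_self _ _) z h1 h2.symm
        · exact hbw h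
    · exact hG.geodesic_adj_iff hc hw hwT (hwa ▸ he) hi hia z
    · exact hwT i hi hia (hBT _ h)
    · have := hw.eq_of_eq (by omega) hi h
      omega
  refine ⟨insert b C, a, by omega, hB, fun c hcB => ?_⟩
  rcases eq_or_ne c b with rfl | hcb
  · exact ⟨a, w, Or.inl rfl, hpath⟩
  · exact hG.exists_isPendantPath hc hB hcard hpath (Finset.mem_insert_self _ _) hmin hBT hwT
      hcB hcb

open Classical in
theorem IsMaxSLEE.exists_clique_of_no_inTriangle (hG : G.IsMaxSLEE) (hc : G.Connected) {e e' : V}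
    (he : ¬ G.IsCutVertex e) (he' : ¬ G.IsCutVertex e') (hee' : e ≠ e')
    (hT : ∀ t, ¬ G.InTriangle t) : ∃ B a, G.IsCliqueWithBalancedPaths B a := by
  obtain ⟨y, hy0, hyL, hy⟩ := hc.exists_isGeodesic e e'
  have hLpos : 0 < G.dist e e' := hc.pos_dist_of_ne hee'
  generalize G.dist e e' = L at hyL hy hLpos
  have hinj : ∀ {i j}, i ≤ L → j ≤ L → y i = y j → i = j := fun hi hj h => hy.eq_of_eq hi hj h
  have hadj : ∀ i, 1 ≤ i → i ≤ L → ∀ u, G.Adj (y i) u ↔ u = y (i - 1) ∨ (i < L ∧ u = y (i + 1)) :=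
    fun i hi hiL u => hG.geodesic_adj_iff hc hy (fun i _ _ => hT _) (hyL ▸ he') hi hiL u
  have hadj0 : ∀ u, G.Adj (y 0) u ↔ u = y 1 := by
    intro u
    constructor
    · intro hu
      exact hG.eq_of_not_inTriangle_of_not_isCutVertex hc (hT _) (hy0 ▸ he) hu (hy.adj 0 hLpos)
    · rintro rfl
      exact hy.adj 0 hLpos
  have hadj' : ∀ i ≤ L, ∀ u, G.Adj (y i) u ↔ (0 < i ∧ u = y (i - 1)) ∨ (i < L ∧ u = y (i + 1)) := by
    intro i hi u
    rcases Nat.eq_zero_or_pos i with rfl | h0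
    · rw [hadj0]
      simp [hLpos]
    · rw [hadj i h0 hi]
      simp [h0]
  -- The graph is the path `y 0, …, y L`. Its middle edge serves as the clique, with `k` further
  -- vertices on one side and `L - k - 1`, that is `k` or `k + 1`, on the other.
  obtain ⟨k, hk⟩ : ∃ k, k = (L - 1) / 2 := ⟨_, rfl⟩
  have hne : y k ≠ y (k + 1) := fun h => by
    have := hinj (by omega) (by omega) h
    omega
  have hB : ∀ u, u ∈ ({y k, y (k + 1)} : Finset V) ↔ u = y k ∨ u = y (k + 1) := by
    intro u
    simp
  refine ⟨{y k, y (k + 1)}, k, by rw [Finset.card_pair hne], ?_, ?_⟩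
  · intro u hu v hv huv
    rw [hB] at hu hv
    have := hy.adj k (by omega)
    rcases hu with rfl | rfl <;> rcases hv with rfl | rfl
    exacts [absurd rfl huv, this, this.symm, absurd rfl huv]
  · intro c hcB
    rw [hB] at hcB
    rcases hcB with rfl | rfl
    · refine ⟨k, fun i => y (k - i), Or.inl rfl, rfl, fun u => ?_, fun i hi hik u => ?_,
        fun i hi hik h => ?_, fun i hi h => ?_⟩
      · rw [hadj' k (by omega), hB]
        constructor
        · rintro (⟨h, rfl⟩ | ⟨h, rfl⟩)
          · exact Or.inr ⟨h, rfl⟩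
          · exact Or.inl ⟨Or.inr rfl, hne.symm⟩
        · rintro (⟨rfl | rfl, h⟩ | h)
          · exact absurd rfl h
          · exact Or.inr ⟨by omega, rfl⟩
          · exact Or.inl h
      · rw [hadj' (k - i) (by omega), show k - i + 1 = k - (i - 1) by omega,
          show k - i - 1 = k - (i + 1) by omega, or_comm]
        have h1 : k - i < L := by omega
        have h2 : 0 < k - i ↔ i < k := by omega
        rw [h2]
        tauto
      · rw [hB] at h
        rcases h with h | h <;> have := hinj (by omega) (by omega) h <;> omega
      · have := hinj (by omega) (by omega) h
        omega
    · refine ⟨L - k - 1, fun i => y (k + 1 + i), by omega, rfl, fun u => ?_, fun i hi hik u => ?_,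
        fun i hi hik h => ?_, fun i hi h => ?_⟩
      · rw [hadj' (k + 1) (by omega), hB]
        constructor
        · rintro (⟨h, rfl⟩ | ⟨h, rfl⟩)
          · exact Or.inl ⟨Or.inl rfl, hne⟩
          · exact Or.inr ⟨by omega, rfl⟩
        · rintro (⟨rfl | rfl, h⟩ | h)
          · exact Or.inl ⟨by omega, rfl⟩
          · exact absurd rfl h
          · exact Or.inr ⟨by omega, h.2⟩
      · rw [hadj' (k + 1 + i) (by omega), show k + 1 + i - 1 = k + 1 + (i - 1) by omega,
          show k + 1 + i + 1 = k + 1 + (i + 1) by omega]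
        have h1 : 0 < k + 1 + i := by omega
        have h2 : k + 1 + i < L ↔ i < L - k - 1 := by omega
        rw [h2]
        tauto
      · rw [hB] at h
        rcases h with h | h <;> have := hinj (by omega) (by omega) h <;> omega
      · have := hinj (by omega) (by omega) h
        omega

end Structure

/-! ### Invariance under isomorphism -/

section IsoInvariance

open Classical in
theorem Iso.SLEE_eq {V W : Type*} [Fintype V] [Fintype W] {G : SimpleGraph V} {H : SimpleGraph W}
    (φ : G ≃g H) : G.SLEE = H.SLEE := by
  have hpow : ∀ k u v, (G.signlessLapMatrix ^ k) u v = (H.signlessLapMatrix ^ k) (φ u) (φ v) := by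
    intro k
    induction k with
    | zero => intro u v; simp [Matrix.one_apply]
    | succ k ih =>
      intro u v
      rw [signlessLapMatrix_pow_succ_apply, signlessLapMatrix_pow_succ_apply]
      refine Finset.sum_equiv φ.toEquiv (fun x => ?_) fun x _ => ?_
      · rw [mem_neighborFinset, mem_neighborFinset]
        exact φ.map_adj_iff.symm
      · rw [ih, ih]
        rfl
  refine HasSum.unique G.hasSum_SLEE ?_
  convert H.hasSum_SLEE using 3 with k
  exact Fintype.sum_equiv φ.toEquiv _ _ fun x => hpow k x x

end IsoInvariance

/-! ### The graphs `cliqueWithPaths` -/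

section CliqueWithPaths

variable {m : ℕ} {l l' : Fin m → ℕ}

theorem cliqueWithPaths_vertex_ext {x y : Σ i : Fin m, Fin (l i + 1)} (h₁ : x.1 = y.1)
    (h₂ : (x.2 : ℕ) = y.2) : x = y := by
  obtain ⟨i, a⟩ := x
  obtain ⟨j, b⟩ := y
  obtain rfl : i = j := h₁
  exact congrArg _ (Fin.ext h₂)

theorem cliqueWithPaths_adj {x y : Σ i : Fin m, Fin (l i + 1)} : (cliqueWithPaths l).Adj x y ↔
    (x.1 = y.1 ∧ ((x.2 : ℕ) + 1 = y.2 ∨ (y.2 : ℕ) + 1 = x.2)) ∨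
      (x.1 ≠ y.1 ∧ (x.2 : ℕ) = 0 ∧ (y.2 : ℕ) = 0) := Iff.rfl

/-- The last vertex of a path has a clique as its neighbourhood; any other vertex separates the
outer part of its path from the rest, which is nonempty since `m ≥ 2`. -/
theorem isCutVertex_cliqueWithPaths_iff (hm : 2 ≤ m) (v : Σ i : Fin m, Fin (l i + 1)) :
    (cliqueWithPaths l).IsCutVertex v ↔ (v.2 : ℕ) < l v.1 := by
  obtain ⟨i, a⟩ := v
  constructor
  · contrapose!
    intro ha
    have ha' : (a : ℕ) = l i := le_antisymm (Nat.lt_succ_iff.1 a.2) ha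
    refine not_isCutVertex_of_clique fun x y hx hy hxy => ?_
    rw [cliqueWithPaths_adj] at hx hy ⊢
    dsimp only at hx hy
    have hx2 : i = x.1 → (x.2 : ℕ) ≤ l i := fun h =>
      (Nat.lt_succ_iff.1 x.2.2).trans_eq (congrArg l h.symm)
    have hy2 : i = y.1 → (y.2 : ℕ) ≤ l i := fun h =>
      (Nat.lt_succ_iff.1 y.2.2).trans_eq (congrArg l h.symm)
    rcases hx with ⟨hx1, hx⟩ | ⟨hx1, hx⟩ <;> rcases hy with ⟨hy1, hy⟩ | ⟨hy1, hy⟩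
    · have := hx2 hx1
      have := hy2 hy1
      exact absurd (cliqueWithPaths_vertex_ext (hx1.symm.trans hy1) (by omega)) hxy
    · have := hx2 hx1
      omega
    · have := hy2 hy1
      omega
    · exact Or.inr ⟨fun h => hxy (cliqueWithPaths_vertex_ext h (by omega)), hx.2, hy.2⟩
  · intro ha
    dsimp only at ha
    have hnbr : ∃ y, (cliqueWithPaths l).Adj ⟨i, a⟩ y ∧ ¬ (y.1 = i ∧ (a : ℕ) < y.2) := by
      rcases Nat.eq_zero_or_pos (a : ℕ) with h0 | h0
      · have : Nontrivial (Fin m) := Fin.nontrivial_iff_two_le.2 hm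
        obtain ⟨j, hj⟩ := exists_ne i
        exact ⟨⟨j, 0⟩, cliqueWithPaths_adj.2 (Or.inr ⟨hj.symm, h0, rfl⟩), fun h => hj h.1⟩
      · refine ⟨⟨i, ⟨a - 1, by omega⟩⟩, cliqueWithPaths_adj.2 (Or.inl ⟨rfl, Or.inr ?_⟩), ?_⟩
        · dsimp only
          omega
        · dsimp only
          omega
    obtain ⟨y, hy, hyP⟩ := hnbr
    refine isCutVertex_iff.2 ⟨⟨i, ⟨a + 1, by omega⟩⟩, y, Or.inl ⟨rfl, Or.inl rfl⟩, hy,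
      fun hcon => hyP ?_⟩
    refine hcon.mem_of_closed (P := fun z => z.1 = i ∧ (a : ℕ) < z.2) (fun p q hpq hp => ?_)
      ⟨rfl, Nat.lt_succ_self _⟩
    rw [deleteIncidenceSet_adj, cliqueWithPaths_adj] at hpq
    obtain ⟨⟨h1, h2⟩ | ⟨h1, h2⟩, -, hq⟩ := hpq
    · refine ⟨h1.symm.trans hp.1, lt_of_le_of_ne (by omega) fun h => hq ?_⟩
      exact cliqueWithPaths_vertex_ext (h1.symm.trans hp.1) h.symm
    · omega

theorem cutVertexCount_cliqueWithPaths (hm : 2 ≤ m) :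
    (cliqueWithPaths l).cutVertexCount = ∑ i, l i := by
  let f : (Σ i : Fin m, Fin (l i)) → Σ i : Fin m, Fin (l i + 1) := fun x => ⟨x.1, x.2.castSucc⟩
  have hf : Function.Injective f := by
    rintro ⟨i, a⟩ ⟨j, b⟩ h
    obtain rfl : i = j := congrArg Sigma.fst h
    simpa [f] using h
  have hrange : {v | (cliqueWithPaths l).IsCutVertex v} = Set.range f := by
    ext v
    rw [Set.mem_ofPred_eq, isCutVertex_cliqueWithPaths_iff hm]
    constructor
    · intro h
      exact ⟨⟨v.1, ⟨v.2, h⟩⟩, rfl⟩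
    · rintro ⟨x, rfl⟩
      exact x.2.2
  rw [cutVertexCount, hrange, ← Nat.card_coe_set_eq, Nat.card_range_of_injective hf,
    Nat.card_eq_fintype_card, Fintype.card_sigma]
  simp

theorem exists_isBalanced (hm : 0 < m) (r : ℕ) : ∃ l : Fin m → ℕ, IsBalanced l r := by
  refine ⟨fun i => r / m + if (i : ℕ) < r % m then 1 else 0, ?_, fun i j => ?_⟩
  · have h : (Finset.filter (fun i => i < r % m) (Finset.range m)) = Finset.range (r % m) := by
      ext i
      have := Nat.mod_lt r hm
      simp only [Finset.mem_filter, Finset.mem_range]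
      omega
    rw [Finset.sum_add_distrib, Finset.sum_const, Finset.card_univ, Fintype.card_fin,
      Fin.sum_univ_eq_sum_range (fun i => if i < r % m then 1 else 0), Finset.sum_boole, h,
      Finset.card_range, smul_eq_mul, Nat.cast_id]
    exact Nat.div_add_mod r m
  · rw [abs_le]
    dsimp only
    split_ifs <;> constructor <;> push_cast <;> linarith

/-- A balanced sequence takes the values `r / m` and `r / m + 1`, the latter `r % m` times. -/
theorem IsBalanced.eq_div_or {r : ℕ} (hm : 0 < m) (h : IsBalanced l r) :
    (∀ i, l i = r / m ∨ l i = r / m + 1) ∧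
      (Finset.univ.filter fun i => l i = r / m + 1).card = r % m := by
  have : Nonempty (Fin m) := ⟨⟨0, hm⟩⟩
  obtain ⟨i₀, hi₀⟩ := Finite.exists_min l
  have hval : ∀ i, l i = l i₀ ∨ l i = l i₀ + 1 := by
    intro i
    have h1 := hi₀ i
    have h2 := abs_le.1 (h.2 i i₀)
    omega
  have hsum : m * l i₀ + (Finset.univ.filter fun i => l i = l i₀ + 1).card = r := by
    have h1 : ∀ i, l i = l i₀ + if l i = l i₀ + 1 then 1 else 0 := by
      intro i
      rcases hval i with h | h <;> simp [h]
    rw [← h.1, Finset.sum_congr rfl fun i _ => h1 i, Finset.sum_add_distrib, Finset.sum_const,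
      Finset.card_univ, Fintype.card_fin, Finset.sum_boole, smul_eq_mul, Nat.cast_id]
  have hlt : (Finset.univ.filter fun i => l i = l i₀ + 1).card < m := by
    have := Finset.card_lt_card (s := Finset.univ.filter fun i => l i = l i₀ + 1)
      (t := Finset.univ) (Finset.filter_ssubset.2 ⟨i₀, Finset.mem_univ _, by omega⟩)
    rwa [Finset.card_univ, Fintype.card_fin] at this
  have hdiv : r / m = l i₀ := by
    rw [← hsum, Nat.mul_add_div hm, Nat.div_eq_of_lt hlt, add_zero]
  have hmod : r % m = (Finset.univ.filter fun i => l i = l i₀ + 1).card := by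
    conv_lhs => rw [← hsum, Nat.mul_add_mod, Nat.mod_eq_of_lt hlt]
  rw [hdiv, hmod]
  exact ⟨hval, rfl⟩

theorem IsBalanced.exists_perm {r : ℕ} (hm : 0 < m) (h : IsBalanced l r) (h' : IsBalanced l' r) :
    ∃ σ : Equiv.Perm (Fin m), ∀ i, l' (σ i) = l i := by
  obtain ⟨h1, h2⟩ := h.eq_div_or hm
  obtain ⟨h1', h2'⟩ := h'.eq_div_or hm
  -- Both sequences take each value equally often, so bijections between fibres assemble to a
  -- permutation.
  have hfib : ∀ v, Nonempty ({i // l i = v} ≃ {i // l' i = v}) := by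
    intro v
    rw [← Fintype.card_eq, Fintype.card_subtype, Fintype.card_subtype]
    by_cases hv1 : v = r / m + 1
    · rw [hv1, h2, h2']
    · by_cases hv : v = r / m
      · subst hv
        have key : ∀ l : Fin m → ℕ, (∀ i, l i = r / m ∨ l i = r / m + 1) →
            (Finset.univ.filter fun i => l i = r / m).card +
              (Finset.univ.filter fun i => l i = r / m + 1).card = m := by
          intro l hl
          have : (Finset.univ.filter fun i => l i = r / m + 1) =
              Finset.univ.filter fun i => ¬ l i = r / m := by
            ext i
            have := hl i
            simp only [Finset.mem_filter, Finset.mem_univ, true_and]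
            omega
          rw [this, Finset.card_filter_add_card_filter_not, Finset.card_univ, Fintype.card_fin]
        have k1 := key l h1
        have k2 := key l' h1'
        omega
      · have key : ∀ l : Fin m → ℕ, (∀ i, l i = r / m ∨ l i = r / m + 1) →
            (Finset.univ.filter fun i => l i = v) = ∅ := by
          intro l hl
          rw [Finset.filter_eq_empty_iff]
          intro i _ hi
          have := hl i
          omega
        rw [key l h1, key l' h1']
  exact ⟨Equiv.ofFiberEquiv fun v => (hfib v).some, fun i => Equiv.ofFiberEquiv_map _ _⟩

theorem IsBalanced.nonempty_iso {r : ℕ} (hm : 0 < m) (h : IsBalanced l r) (h' : IsBalanced l' r) :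
    Nonempty (cliqueWithPaths l ≃g cliqueWithPaths l') := by
  obtain ⟨σ, hσ⟩ := h.exists_perm hm h'
  let f : (Σ i : Fin m, Fin (l i + 1)) → Σ i : Fin m, Fin (l' i + 1) := fun x =>
    ⟨σ x.1, Fin.cast (by rw [hσ]) x.2⟩
  have hf : Function.Bijective f := by
    rw [Fintype.bijective_iff_injective_and_card]
    refine ⟨fun x y hxy => ?_, ?_⟩
    · refine cliqueWithPaths_vertex_ext (σ.injective (congrArg Sigma.fst hxy)) ?_
      exact congrArg (fun z : (Σ i : Fin m, Fin (l' i + 1)) => (z.2 : ℕ)) hxy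
    · simp [Finset.sum_add_distrib, h.1, h'.1]
  refine ⟨⟨Equiv.ofBijective f hf, fun {x y} => ?_⟩⟩
  rw [cliqueWithPaths_adj, cliqueWithPaths_adj]
  simp [f]

theorem IsCliqueWithBalancedPaths.exists_iso {V : Type*} [Fintype V] {G : SimpleGraph V}
    {B : Finset V} {a : ℕ} (h : G.IsCliqueWithBalancedPaths B a) (hc : G.Connected) :
    ∃ l : Fin B.card → ℕ, (∀ i, l i = a ∨ l i = a + 1) ∧ Nonempty (cliqueWithPaths l ≃g G) := by
  obtain ⟨hcard, hB, hpaths⟩ := h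
  let e : Fin B.card ≃ B := B.equivFin.symm
  have hpaths' : ∀ i, ∃ l p, (l = a ∨ l = a + 1) ∧ G.IsPendantPath B (e i) l p := fun i =>
    hpaths (e i) (e i).2
  choose l p hl hp using hpaths'
  refine ⟨l, hl, ?_⟩
  have hinj : ∀ {i j k n}, k ≤ l i → n ≤ l j → (p i k = p j n ↔ i = j ∧ k = n) := by
    intro i j k n hk hn
    refine ⟨fun h => ?_, fun h => by rw [h.1, h.2]⟩
    have heq : ∀ {i j}, (e i : V) = e j → i = j := fun h => e.injective (Subtype.ext h)
    have := (hp i).eq_of_eq (hp j) (e i).2 (e j).2 (fun h => by rw [heq h]) k hk n hn h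
    exact ⟨heq this.1, this.2⟩
  have hmem : ∀ {i k}, k ≤ l i → (p i k ∈ B ↔ k = 0) := by
    intro i k hk
    constructor
    · intro h
      by_contra h0
      exact (hp i).notMem k (by omega) hk h
    · rintro rfl
      rw [(hp i).zero]
      exact (e i).2
  have hadj : ∀ {i j k n}, k ≤ l i → n ≤ l j → (G.Adj (p i k) (p j n) ↔
      (i = j ∧ (k + 1 = n ∨ n + 1 = k)) ∨ (i ≠ j ∧ k = 0 ∧ n = 0)) := by
    intro i j k n hk hn
    rcases Nat.eq_zero_or_pos k with rfl | h0
    · rw [(hp i).zero, (hp i).adj_zero, hmem hn, ← (hp i).zero, Ne, hinj hn hk]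
      have h1 : (0 < l i ∧ p j n = p i 1) ↔ i = j ∧ 1 = n := by
        constructor
        · rintro ⟨h1, h2⟩
          rw [hinj hn h1] at h2
          exact ⟨h2.1.symm, h2.2.symm⟩
        · rintro ⟨rfl, rfl⟩
          exact ⟨hn, rfl⟩
      rw [h1]
      grind
    · rw [(hp i).adj k h0 hk, hinj hn (by omega)]
      have h1 : (k < l i ∧ p j n = p i (k + 1)) ↔ i = j ∧ k + 1 = n := by
        constructor
        · rintro ⟨h1, h2⟩
          rw [hinj hn h1] at h2
          exact ⟨h2.1.symm, h2.2.symm⟩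
        · rintro ⟨rfl, rfl⟩
          exact ⟨hn, rfl⟩
      rw [h1]
      grind
  let f : (Σ i : Fin B.card, Fin (l i + 1)) → V := fun x => p x.1 x.2
  have hle : ∀ x : (Σ i : Fin B.card, Fin (l i + 1)), (x.2 : ℕ) ≤ l x.1 := fun x =>
    Nat.lt_succ_iff.1 x.2.2
  have hf : Function.Bijective f := by
    refine ⟨fun x y hxy => ?_, fun v => ?_⟩
    · have := (hinj (hle x) (hle y)).1 hxy
      exact cliqueWithPaths_vertex_ext this.1 this.2
    · let i₀ : Fin B.card := ⟨0, by omega⟩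
      -- The union of the pendent paths is closed under adjacency, hence everything by
      -- connectedness.
      have hv := (hc (p i₀ 0) v).mem_of_closed (P := fun z => ∃ i, ∃ k ≤ l i, p i k = z)
        (fun u v huv hu => ?_) ⟨i₀, 0, Nat.zero_le _, rfl⟩
      · obtain ⟨i, k, hk, rfl⟩ := hv
        exact ⟨⟨i, ⟨k, Nat.lt_succ_iff.2 hk⟩⟩, rfl⟩
      · obtain ⟨i, k, hk, rfl⟩ := hu
        rcases Nat.eq_zero_or_pos k with rfl | h0
        · rw [(hp i).zero, (hp i).adj_zero] at huv
          rcases huv with ⟨h, -⟩ | ⟨h, rfl⟩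
          · refine ⟨e.symm ⟨v, h⟩, 0, Nat.zero_le _, ?_⟩
            rw [(hp _).zero, Equiv.apply_symm_apply]
          · exact ⟨i, 1, h, rfl⟩
        · rw [(hp i).adj k h0 hk] at huv
          rcases huv with rfl | ⟨h, rfl⟩
          · exact ⟨i, k - 1, by omega, rfl⟩
          · exact ⟨i, k + 1, h, rfl⟩
  exact ⟨⟨Equiv.ofBijective f hf, fun {x y} => hadj (hle x) (hle y)⟩⟩

theorem card_cliqueWithPaths_vertices {r : ℕ} (hl : IsBalanced l r) :
    Fintype.card (Σ i : Fin m, Fin (l i + 1)) = r + m := by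
  rw [Fintype.card_sigma]
  simp [Finset.sum_add_distrib, hl.1]

end CliqueWithPaths

/-! ### Conclusion -/

/-- The maximal graphs are the cliques with balanced pendent paths. -/
theorem IsMaxSLEE.nonempty_iso {V : Type*} [Fintype V] {G : SimpleGraph V} (hG : G.IsMaxSLEE)
    {n r : ℕ} (hr : r + 2 ≤ n) (hn : Fintype.card V = n) (hGr : G.cutVertexCount = r)
    {l : Fin (n - r) → ℕ} (hl : IsBalanced l r) : Nonempty (G ≃g cliqueWithPaths l) := by
  have : Nonempty V := Fintype.card_pos_iff.1 (by omega)
  have hc := hG.connected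
  -- This is where `r ≤ n - 2` supplies two non-cut vertices; the case without triangles needs both.
  obtain ⟨e, e', he, he', hee'⟩ : ∃ e e', ¬ G.IsCutVertex e ∧ ¬ G.IsCutVertex e' ∧ e ≠ e' := by
    have h := Set.ncard_add_ncard_compl {v | G.IsCutVertex v}
    have h' : {v | G.IsCutVertex v}.ncard = r := hGr
    rw [Nat.card_eq_fintype_card, hn, h'] at h
    obtain ⟨e, e', he, he', hne⟩ := (Set.one_lt_ncard_iff).1
      (show 1 < ({v | G.IsCutVertex v}ᶜ).ncard by omega)
    exact ⟨e, e', he, he', hne⟩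
  obtain ⟨B, a, hBa⟩ : ∃ B a, G.IsCliqueWithBalancedPaths B a := by
    by_cases hT : ∃ t, G.InTriangle t
    · obtain ⟨t, ht⟩ := hT
      exact hG.exists_clique_of_inTriangle hc he ht
    · push Not at hT
      exact hG.exists_clique_of_no_inTriangle hc he he' hee' hT
  obtain ⟨l', hl', ⟨φ⟩⟩ := hBa.exists_iso hc
  have hcount := cutVertexCount_cliqueWithPaths (l := l') hBa.1
  rw [← φ.cutVertexCount_eq, hGr] at hcount
  have hbal : IsBalanced l' r := by
    refine ⟨hcount.symm, fun i j => ?_⟩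
    rw [abs_le]
    have h1 := hl' i
    have h2 := hl' j
    omega
  have hcard := card_cliqueWithPaths_vertices hbal
  rw [Fintype.card_congr φ.toEquiv, hn] at hcard
  have hm : B.card = n - r := by omega
  have h2 := hBa.1
  generalize B.card = m at l' hm h2 φ hbal
  subst hm
  obtain ⟨ψ⟩ := hbal.nonempty_iso (by omega) hl
  exact ⟨φ.symm.trans ψ⟩

end SimpleGraph

theorem theorem4p2 (n r : ℕ) (hr : r + 2 ≤ n) :
    (∃ l : Fin (n - r) → ℕ, SimpleGraph.IsBalanced l r) ∧
    ∀ l : Fin (n - r) → ℕ, SimpleGraph.IsBalanced l r →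
      Fintype.card (Σ i : Fin (n - r), Fin (l i + 1)) = n ∧
      (SimpleGraph.cliqueWithPaths l).cutVertexCount = r ∧
      ∀ (V : Type*) [Fintype V] (G : SimpleGraph V),
        Fintype.card V = n → G.cutVertexCount = r →
          G.SLEE ≤ (SimpleGraph.cliqueWithPaths l).SLEE ∧
          (G.SLEE = (SimpleGraph.cliqueWithPaths l).SLEE ↔
            Nonempty (G ≃g SimpleGraph.cliqueWithPaths l)) := by
  refine ⟨SimpleGraph.exists_isBalanced (by omega) r, fun l hl => ⟨?_, ?_, ?_⟩⟩
  · rw [SimpleGraph.card_cliqueWithPaths_vertices hl]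
    omega
  · rw [SimpleGraph.cutVertexCount_cliqueWithPaths (by omega), hl.1]
  · intro V _ G hn hGr
    classical
    obtain ⟨M, hMr, hM⟩ := Set.exists_max_image {G : SimpleGraph V | G.cutVertexCount = r}
      SimpleGraph.SLEE (Set.toFinite _) ⟨G, hGr⟩
    rw [Set.mem_ofPred_eq] at hMr
    have hMmax : M.IsMaxSLEE := fun G' hG' => hM G' (hG'.trans hMr)
    obtain ⟨φ⟩ := hMmax.nonempty_iso hr hn hMr hl
    have hle : G.SLEE ≤ (SimpleGraph.cliqueWithPaths l).SLEE := φ.SLEE_eq ▸ hM G hGr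
    refine ⟨hle, fun heq => ?_, fun ⟨ψ⟩ => ψ.SLEE_eq⟩
    -- Equality makes `G` itself a maximizer, so the structure theorem applies to it.
    refine SimpleGraph.IsMaxSLEE.nonempty_iso (fun G' hG' => ?_) hr hn hGr hl
    rw [heq, ← φ.SLEE_eq]
    exact hM G' (hG'.trans hGr)
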